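/- All manifolds are finite-dimensional, Hausdorff, second countable and without boundary, and all manifolds, maps and bundles are $C^\infty$. A control system $\mathbb C$ on a manifold $X$ is a locally trivial fibration $\pi_{\mathcal U}:\mathcal U\to X$ together with a smooth map $F:\mathcal U\to TX$ over $X$. A trajectory of $\mathbb C$ is a curve $x=\pi_{\mathcal U}\circ c:[a,b]\to X$ ($a<b$), where $c:[a,b]\to\mathcal U$ is measurable and essentially bounded, $x$ is absolutely continuous and $\dot x(t)=F(c(t))$ for almost every $t$. $\mathbb C$ is locally controllable at $x_0\in X$ if for every open neighbourhood $V$ of $x_0$ there is an open neighbourhood $W\subset V$ of $x_0$ such that any two points $x_1,x_2\in W$ are joined by a trajectory of the restriction $\mathbb C|_V$, i.e. by a trajectory of $\mathbb C$ contained in $V$. If $\pi:X\to Y$ is a fibration such that $\pi\circ\pi_{\mathcal U}$ is a fibration, then the quotient $\mathbb C/\pi$ is the control system $\mathcal U\xrightarrow{\pi_*\circ F}TY\to Y$ on $Y$. A distribution $D\subset TX$ (a vector subbundle) is regarded as the control system $\mathbb D: D\hookrightarrow TX\to X$. **Lemma 5.2.** Let $M$ be a manifold with a pseudo-product structure, i.e.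 a distribution $E\subset TM$ with a decomposition $E=L\oplus K$ into integrable subbundles, let $\mathbb E,\mathbb L,\mathbb K$ be the control systems of $E$, $L$, $K$, and let $z_0\in M$. Suppose that $E$ is bracket generating near $z_0$: for every $z$ in a neighbourhood of $z_0$, the iterated Lie brackets of local sections of $E$ near $z$ span $T_zM$. Then: 1. $\mathbb E$ is locally controllable at $z_0$. 2. Let $\pi_N:M\to N$ be a fibration with $\ker \pi_{N*}=K$. If $E\to M\xrightarrow{\pi_N}N$ is a fibration, then $\mathbb E/\pi_N$ is locally controllable at $\pi_N(z_0)$; if $L\to M\xrightarrow{\pi_N}N$ is a fibration, then $\mathbb L/\pi_N$ is locally controllable at $\pi_N(z_0)$. 3. Let $\pi_P:M\to P$ be a fibration with $\ker \pi_{P*}=L$. If $E\to M\xrightarrow{\pi_P}P$ is a fibration, then $\mathbb E/\pi_P$ is locally controllable at $\pi_P(z_0)$; if $K\to M\xrightarrow{\pi_P}P$ is a fibration, then $\mathbb K/\pi_P$ is locally controllable at $\pi_P(z_0)$. -/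

import Mathlib

open Set Filter Topology Bundle MeasureTheory
open scoped Manifold ContDiff

namespace PseudoProduct

noncomputable section

/-! ### Distributions and their total spaces -/

/-- `s` is a smooth frame over `O` of the family `D` of subspaces of the tangent spaces. -/
structure IsFrameOn {m r : ℕ} {M : Type*} [TopologicalSpace M]
    [ChartedSpace (EuclideanSpace ℝ (Fin m)) M] [IsManifold (𝓡 m) ∞ M]
    (D : ∀ z : M, Submodule ℝ (TangentSpace (𝓡 m) z))
    (s : Fin r → ∀ z : M, TangentSpace (𝓡 m) z) (O : Set M) : Prop where
  smooth : ∀ i, ContMDiffOn (𝓡 m) (𝓡 m).tangent ∞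
    (fun z => (⟨z, s i z⟩ : TangentBundle (𝓡 m) M)) O
  linearIndependent : ∀ z ∈ O, LinearIndependent ℝ (fun i => s i z)
  span_eq : ∀ z ∈ O, Submodule.span ℝ (range fun i => s i z) = D z

/-- A distribution on `M`, i.e. a smooth vector subbundle of `TM` of constant rank: a family of
subspaces of the tangent spaces which has a smooth frame near every point. -/
structure TangentDistribution (m : ℕ) (M : Type*) [TopologicalSpace M]
    [ChartedSpace (EuclideanSpace ℝ (Fin m)) M] [IsManifold (𝓡 m) ∞ M] where
  rank : ℕ
  fiber : ∀ z : M, Submodule ℝ (TangentSpace (𝓡 m) z)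
  exists_frame : ∀ z : M, ∃ O : Set M, IsOpen O ∧ z ∈ O ∧
    ∃ s : Fin rank → ∀ y : M, TangentSpace (𝓡 m) y, IsFrameOn fiber s O

section Bundle

variable {m : ℕ} {M : Type*} [TopologicalSpace M]
  [ChartedSpace (EuclideanSpace ℝ (Fin m)) M] [IsManifold (𝓡 m) ∞ M]

/-- The linear map `a ↦ ∑ aᵢ sᵢ(z)`. -/
def frameMap {r : ℕ} (s : Fin r → ∀ z : M, TangentSpace (𝓡 m) z) (z : M) :
    EuclideanSpace ℝ (Fin r) →ₗ[ℝ] TangentSpace (𝓡 m) z :=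
  Fintype.linearCombination ℝ (fun i => s i z) ∘ₗ
    (WithLp.linearEquiv 2 ℝ (Fin r → ℝ)).toLinearMap

theorem frameMap_apply {r : ℕ} (s : Fin r → ∀ z : M, TangentSpace (𝓡 m) z) (z : M)
    (a : EuclideanSpace ℝ (Fin r)) : frameMap s z a = ∑ i, a i • s i z := by
  simp [frameMap, Fintype.linearCombination_apply]

theorem IsFrameOn.injective {r : ℕ} {D : ∀ z : M, Submodule ℝ (TangentSpace (𝓡 m) z)}
    {s : Fin r → ∀ z : M, TangentSpace (𝓡 m) z} {O : Set M} (h : IsFrameOn D s O)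
    {z : M} (hz : z ∈ O) : Function.Injective (frameMap s z) := by
  have := (h.linearIndependent z hz).fintypeLinearCombination_injective
  exact this.comp (WithLp.linearEquiv 2 ℝ (Fin r → ℝ)).injective

theorem IsFrameOn.range_eq {r : ℕ} {D : ∀ z : M, Submodule ℝ (TangentSpace (𝓡 m) z)}
    {s : Fin r → ∀ z : M, TangentSpace (𝓡 m) z} {O : Set M} (h : IsFrameOn D s O)
    {z : M} (hz : z ∈ O) : LinearMap.range (frameMap s z) = D z := by
  rw [← h.span_eq z hz, frameMap, LinearMap.range_comp_of_range_eq_top _ (LinearEquiv.range _)]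
  exact Fintype.range_linearCombination ℝ (fun i => s i z)

/-- The coordinates on `D z` given by a frame. -/
def IsFrameOn.equiv {r : ℕ} {D : ∀ z : M, Submodule ℝ (TangentSpace (𝓡 m) z)}
    {s : Fin r → ∀ z : M, TangentSpace (𝓡 m) z} {O : Set M} (h : IsFrameOn D s O)
    {z : M} (hz : z ∈ O) : EuclideanSpace ℝ (Fin r) ≃ₗ[ℝ] D z :=
  (LinearEquiv.ofInjective (frameMap s z) (h.injective hz)).trans
    (LinearEquiv.ofEq _ _ (h.range_eq hz))

theorem IsFrameOn.coe_equiv {r : ℕ} {D : ∀ z : M, Submodule ℝ (TangentSpace (𝓡 m) z)}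
    {s : Fin r → ∀ z : M, TangentSpace (𝓡 m) z} {O : Set M} (h : IsFrameOn D s O)
    {z : M} (hz : z ∈ O) (a : EuclideanSpace ℝ (Fin r)) :
    ((h.equiv hz a : D z) : TangentSpace (𝓡 m) z) = frameMap s z a := rfl

namespace TangentDistribution

variable (D : TangentDistribution m M)

/-- The fibre over `z` of the total space of the distribution. -/
abbrev Fib (z : M) : Type := D.fiber z

open Classical in
/-- The local trivialization of the total space of `D` given by a frame. -/
def framePretrivialization {s : Fin D.rank → ∀ z : M, TangentSpace (𝓡 m) z} {O : Set M}
    (hO : IsOpen O) (h : IsFrameOn D.fiber s O) :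
    Pretrivialization (EuclideanSpace ℝ (Fin D.rank))
      (π (EuclideanSpace ℝ (Fin D.rank)) D.Fib) where
  toFun p := (p.1, if hz : p.1 ∈ O then (h.equiv hz).symm p.2 else 0)
  invFun p := ⟨p.1, if hz : p.1 ∈ O then h.equiv hz p.2 else 0⟩
  source := TotalSpace.proj ⁻¹' O
  target := O ×ˢ univ
  map_source' := fun ⟨_, _⟩ hz => ⟨hz, mem_univ _⟩
  map_target' := fun ⟨_, _⟩ hz => hz.1
  left_inv' := fun ⟨z, v⟩ hz => by
    have hz' : z ∈ O := hz
    simp [hz']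
  right_inv' := fun ⟨z, v⟩ hz => by
    have hz' : z ∈ O := hz.1
    simp [hz']
  open_target := hO.prod isOpen_univ
  baseSet := O
  open_baseSet := hO
  source_eq := rfl
  target_eq := rfl
  proj_toFun _ _ := rfl

open Classical in
theorem framePretrivialization_apply {s : Fin D.rank → ∀ z : M, TangentSpace (𝓡 m) z} {O : Set M}
    (hO : IsOpen O) (h : IsFrameOn D.fiber s O) {z : M} (hz : z ∈ O) (v : D.Fib z) :
    D.framePretrivialization hO h ⟨z, v⟩ = (z, (h.equiv hz).symm v) := by
  change (z, dite (z ∈ O) (fun hz => (h.equiv hz).symm v) fun _ => 0) = _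
  simp [hz]

open Classical in
theorem framePretrivialization_symm {s : Fin D.rank → ∀ z : M, TangentSpace (𝓡 m) z} {O : Set M}
    (hO : IsOpen O) (h : IsFrameOn D.fiber s O) {z : M} (hz : z ∈ O)
    (a : EuclideanSpace ℝ (Fin D.rank)) :
    (D.framePretrivialization hO h).symm z a = h.equiv hz a := by
  rw [Pretrivialization.symm_apply _ hz]
  change (dite (z ∈ O) (fun hz => h.equiv hz a) fun _ => 0) = h.equiv hz a
  simp [hz]

open Classical in
/-- The change of coordinates between two frames. -/
def coordChange {s s' : Fin D.rank → ∀ z : M, TangentSpace (𝓡 m) z} {O O' : Set M}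
    (h : IsFrameOn D.fiber s O) (h' : IsFrameOn D.fiber s' O') (z : M) :
    EuclideanSpace ℝ (Fin D.rank) →L[ℝ] EuclideanSpace ℝ (Fin D.rank) :=
  if hz : z ∈ O ∩ O' then
    LinearMap.toContinuousLinearMap ((h.equiv hz.1).trans (h'.equiv hz.2).symm).toLinearMap
  else 0

theorem frameMap_coordChange {s s' : Fin D.rank → ∀ z : M, TangentSpace (𝓡 m) z} {O O' : Set M}
    (h : IsFrameOn D.fiber s O) (h' : IsFrameOn D.fiber s' O') {z : M} (hz : z ∈ O ∩ O')
    (a : EuclideanSpace ℝ (Fin D.rank)) :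
    frameMap s' z (D.coordChange h h' z a) = frameMap s z a := by
  rw [← h'.coe_equiv hz.2, ← h.coe_equiv hz.1]
  simp [coordChange, hz]

/-- A frame read in the trivialization of the tangent bundle at `z₀`. -/
def frameMatrix {r : ℕ} (s : Fin r → ∀ z : M, TangentSpace (𝓡 m) z) (z₀ z : M) :
    EuclideanSpace ℝ (Fin r) →L[ℝ] EuclideanSpace ℝ (Fin m) :=
  ∑ i, (EuclideanSpace.proj i : EuclideanSpace ℝ (Fin r) →L[ℝ] ℝ).smulRight
    (trivializationAt (EuclideanSpace ℝ (Fin m)) (TangentSpace (𝓡 m)) z₀ ⟨z, s i z⟩).2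

theorem frameMatrix_apply {r : ℕ} (s : Fin r → ∀ z : M, TangentSpace (𝓡 m) z) {z₀ z : M}
    (hz : z ∈ (trivializationAt (EuclideanSpace ℝ (Fin m)) (TangentSpace (𝓡 m)) z₀).baseSet)
    (a : EuclideanSpace ℝ (Fin r)) :
    frameMatrix s z₀ z a =
      (trivializationAt (EuclideanSpace ℝ (Fin m)) (TangentSpace (𝓡 m)) z₀).linearMapAt ℝ z
        (frameMap s z a) := by
  rw [frameMap_apply, map_sum]
  simp only [frameMatrix, sum_apply, map_smul]
  refine Finset.sum_congr rfl fun i _ => ?_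
  rw [Trivialization.coe_linearMapAt_of_mem _ hz]
  rfl

theorem contMDiffOn_frameMatrix {r : ℕ} {D : ∀ z : M, Submodule ℝ (TangentSpace (𝓡 m) z)}
    {s : Fin r → ∀ z : M, TangentSpace (𝓡 m) z} {O : Set M} (hO : IsOpen O)
    (h : IsFrameOn D s O) (z₀ : M) :
    ContMDiffOn (𝓡 m) 𝓘(ℝ, EuclideanSpace ℝ (Fin r) →L[ℝ] EuclideanSpace ℝ (Fin m)) ∞
      (frameMatrix s z₀)
      (O ∩ (trivializationAt (EuclideanSpace ℝ (Fin m)) (TangentSpace (𝓡 m)) z₀).baseSet) := by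
  have key : ∀ i, ContMDiffOn (𝓡 m) 𝓘(ℝ, EuclideanSpace ℝ (Fin m)) ∞
      (fun z => (trivializationAt (EuclideanSpace ℝ (Fin m)) (TangentSpace (𝓡 m)) z₀
        ⟨z, s i z⟩).2)
      (O ∩ (trivializationAt (EuclideanSpace ℝ (Fin m)) (TangentSpace (𝓡 m)) z₀).baseSet) := by
    intro i
    rw [← Trivialization.contMDiffOn_section_iff (IB := 𝓡 m) _
      (hO.inter (Trivialization.open_baseSet _)) inter_subset_right]
    exact (h.smooth i).mono inter_subset_left
  unfold frameMatrix
  refine contMDiffOn_finsetSum fun i _ => ?_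
  have hL : ContDiff ℝ ∞ (fun v : EuclideanSpace ℝ (Fin m) =>
      (EuclideanSpace.proj i : EuclideanSpace ℝ (Fin r) →L[ℝ] ℝ).smulRight v) :=
    ContDiff.smulRight contDiff_const contDiff_id
  exact hL.contMDiff.comp_contMDiffOn (key i)

theorem contMDiffOn_coordChange {s s' : Fin D.rank → ∀ z : M, TangentSpace (𝓡 m) z}
    {O O' : Set M} (hO : IsOpen O) (hO' : IsOpen O')
    (h : IsFrameOn D.fiber s O) (h' : IsFrameOn D.fiber s' O') :
    ContMDiffOn (𝓡 m)
      𝓘(ℝ, EuclideanSpace ℝ (Fin D.rank) →L[ℝ] EuclideanSpace ℝ (Fin D.rank)) ∞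
      (D.coordChange h h') (O ∩ O') := by
  intro z₀ hz₀
  refine ContMDiffAt.contMDiffWithinAt ?_
  set B := (trivializationAt (EuclideanSpace ℝ (Fin m)) (TangentSpace (𝓡 m)) z₀).baseSet with hB
  have hBo : IsOpen B := Trivialization.open_baseSet _
  have hzB : z₀ ∈ B := FiberBundle.mem_baseSet_trivializationAt' z₀
  -- a left inverse of the second frame at the base point
  have hinj : Function.Injective (frameMatrix s' z₀ z₀) := by
    intro a b hab
    rw [frameMatrix_apply s' hzB, frameMatrix_apply s' hzB] at hab
    refine h'.injective hz₀.2 ?_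
    have := congrArg ((trivializationAt (EuclideanSpace ℝ (Fin m))
      (TangentSpace (𝓡 m)) z₀).symmₗ ℝ z₀) hab
    rwa [Trivialization.symmₗ_linearMapAt _ hzB, Trivialization.symmₗ_linearMapAt _ hzB] at this
  obtain ⟨T₀, hT₀⟩ := LinearMap.exists_leftInverse_of_injective
    (frameMatrix s' z₀ z₀ : EuclideanSpace ℝ (Fin D.rank) →ₗ[ℝ] EuclideanSpace ℝ (Fin m))
    (LinearMap.ker_eq_bot.2 hinj)
  set T : EuclideanSpace ℝ (Fin m) →L[ℝ] EuclideanSpace ℝ (Fin D.rank) :=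
    LinearMap.toContinuousLinearMap T₀ with hT
  have hTid : T.comp (frameMatrix s' z₀ z₀) = ContinuousLinearMap.id ℝ _ := by
    ext1 a
    exact LinearMap.congr_fun hT₀ a
  have hc : ContDiff ℝ ∞ (fun A : EuclideanSpace ℝ (Fin D.rank) →L[ℝ] EuclideanSpace ℝ (Fin m) =>
      T.comp A) := ContDiff.clm_comp contDiff_const contDiff_id
  have hA : ContMDiffAt (𝓡 m)
      𝓘(ℝ, EuclideanSpace ℝ (Fin D.rank) →L[ℝ] EuclideanSpace ℝ (Fin D.rank)) ∞
      (fun z => T.comp (frameMatrix s z₀ z)) z₀ :=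
    hc.contMDiff.contMDiffAt.comp z₀ ((contMDiffOn_frameMatrix hO h z₀).contMDiffAt
      ((hO.inter hBo).mem_nhds ⟨hz₀.1, hzB⟩))
  have hA' : ContMDiffAt (𝓡 m)
      𝓘(ℝ, EuclideanSpace ℝ (Fin D.rank) →L[ℝ] EuclideanSpace ℝ (Fin D.rank)) ∞
      (fun z => T.comp (frameMatrix s' z₀ z)) z₀ :=
    hc.contMDiff.contMDiffAt.comp z₀ ((contMDiffOn_frameMatrix hO' h' z₀).contMDiffAt
      ((hO'.inter hBo).mem_nhds ⟨hz₀.2, hzB⟩))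
  have hInv : ContMDiffAt (𝓡 m)
      𝓘(ℝ, EuclideanSpace ℝ (Fin D.rank) →L[ℝ] EuclideanSpace ℝ (Fin D.rank)) ∞
      (fun z => ContinuousLinearMap.inverse (T.comp (frameMatrix s' z₀ z))) z₀ := by
    have h1 : ContDiffAt ℝ ∞ ContinuousLinearMap.inverse (T.comp (frameMatrix s' z₀ z₀)) := by
      rw [hTid]
      exact contDiffAt_map_inverse (ContinuousLinearEquiv.refl ℝ _)
    exact h1.contMDiffAt.comp z₀ hA'
  have hFin : ContMDiffAt (𝓡 m) 
      𝓘(ℝ, EuclideanSpace ℝ (Fin D.rank) →L[ℝ] EuclideanSpace ℝ (Fin D.rank)) ∞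
      (fun z => (ContinuousLinearMap.inverse (T.comp (frameMatrix s' z₀ z))).comp
      (T.comp (frameMatrix s z₀ z))) z₀ := hInv.clm_comp hA
  refine hFin.congr_of_eventuallyEq ?_
  have hunit : ∀ᶠ z in 𝓝 z₀, IsUnit (T.comp (frameMatrix s' z₀ z)) := by
    refine hA'.continuousAt.eventually (Units.isOpen.mem_nhds ?_)
    change IsUnit (T.comp (frameMatrix s' z₀ z₀))
    rw [hTid]
    exact isUnit_one
  filter_upwards [hunit, (hO.inter hBo).mem_nhds ⟨hz₀.1, hzB⟩, hO'.mem_nhds hz₀.2]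
    with z hu hz hz'
  obtain ⟨u, hu⟩ := hu
  obtain ⟨e, he⟩ : ∃ e : EuclideanSpace ℝ (Fin D.rank) ≃L[ℝ] EuclideanSpace ℝ (Fin D.rank),
      (e : EuclideanSpace ℝ (Fin D.rank) →L[ℝ] EuclideanSpace ℝ (Fin D.rank)) =
        T.comp (frameMatrix s' z₀ z) := ⟨ContinuousLinearEquiv.ofUnit u, hu⟩
  have hcomp : (T.comp (frameMatrix s' z₀ z)).comp (D.coordChange h h' z) =
      T.comp (frameMatrix s z₀ z) := by
    ext1 a
    simp only [ContinuousLinearMap.comp_apply]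
    rw [frameMatrix_apply s' hz.2, frameMatrix_apply s hz.2,
      D.frameMap_coordChange h h' ⟨hz.1, hz'⟩]
  rw [← hcomp, ← he, ContinuousLinearMap.inverse_equiv]
  ext1 a
  simp

/-- The vector bundle structure of the total space of a distribution. -/
def prebundle : VectorPrebundle ℝ (EuclideanSpace ℝ (Fin D.rank)) D.Fib where
  pretrivializationAtlas := {e | ∃ (O : Set M) (s : Fin D.rank → ∀ z : M, TangentSpace (𝓡 m) z)
    (hO : IsOpen O) (h : IsFrameOn D.fiber s O), e = D.framePretrivialization hO h}
  pretrivialization_linear' := by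
    rintro _ ⟨O, s, hO, h, rfl⟩
    refine ⟨fun z hz => ?_⟩
    have : (fun v : D.Fib z => (D.framePretrivialization hO h ⟨z, v⟩).2) =
        (h.equiv hz).symm := by
      funext v
      rw [D.framePretrivialization_apply hO h hz]
    rw [this]
    exact LinearMap.isLinear (h.equiv hz).symm.toLinearMap
  pretrivializationAt z := D.framePretrivialization
    (D.exists_frame z).choose_spec.1 (D.exists_frame z).choose_spec.2.2.choose_spec
  mem_base_pretrivializationAt z := (D.exists_frame z).choose_spec.2.1
  pretrivialization_mem_atlas z := ⟨_, _, _, _, rfl⟩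
  exists_coordChange := by
    rintro _ ⟨O, s, hO, h, rfl⟩ _ ⟨O', s', hO', h', rfl⟩
    refine ⟨D.coordChange h h', (D.contMDiffOn_coordChange hO hO' h h').continuousOn, ?_⟩
    intro z hz a
    rw [D.framePretrivialization_symm hO h hz.1, D.framePretrivialization_apply hO' h' hz.2]
    have hz' : z ∈ O ∩ O' := hz
    simp [coordChange, hz']
  totalSpaceMk_isInducing := by
    intro z
    have hz := (D.exists_frame z).choose_spec.2.1
    set h := (D.exists_frame z).choose_spec.2.2.choose_spec
    have : T2Space (TangentSpace (𝓡 m) z) :=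
      inferInstanceAs (T2Space (EuclideanSpace ℝ (Fin m)))
    have : FiniteDimensional ℝ (TangentSpace (𝓡 m) z) :=
      inferInstanceAs (FiniteDimensional ℝ (EuclideanSpace ℝ (Fin m)))
    have : IsInducing fun v : D.Fib z =>
        (z, (h.equiv hz).symm.toContinuousLinearEquiv v) :=
      isInducing_const_prod.mpr
        ((h.equiv hz).symm.toContinuousLinearEquiv).toHomeomorph.isInducing
    convert this using 1
    ext1 v
    exact D.framePretrivialization_apply _ h hz v

instance : D.prebundle.IsContMDiff (𝓡 m) ∞ where
  exists_contMDiffCoordChange := by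
    rintro _ ⟨O, s, hO, h, rfl⟩ _ ⟨O', s', hO', h', rfl⟩
    refine ⟨D.coordChange h h', D.contMDiffOn_coordChange hO hO' h h', ?_⟩
    intro z hz a
    rw [D.framePretrivialization_symm hO h hz.1, D.framePretrivialization_apply hO' h' hz.2]
    have hz' : z ∈ O ∩ O' := hz
    simp [coordChange, hz']

/-- The total space of a distribution. -/
abbrev Total : Type _ := TotalSpace (EuclideanSpace ℝ (Fin D.rank)) D.Fib

instance : TopologicalSpace D.Total := D.prebundle.totalSpaceTopology

instance : FiberBundle (EuclideanSpace ℝ (Fin D.rank)) D.Fib := D.prebundle.toFiberBundle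

instance : VectorBundle ℝ (EuclideanSpace ℝ (Fin D.rank)) D.Fib := D.prebundle.toVectorBundle

instance : ContMDiffVectorBundle ∞ (EuclideanSpace ℝ (Fin D.rank)) D.Fib (𝓡 m) :=
  D.prebundle.contMDiffVectorBundle (𝓡 m)

/-- The inclusion of a distribution in the tangent bundle, as a map of total spaces. -/
def incl (v : D.Total) : TangentBundle (𝓡 m) M := ⟨v.proj, (v.snd : TangentSpace (𝓡 m) v.proj)⟩

theorem contMDiff_incl :
    ContMDiff ((𝓡 m).prod (𝓡 D.rank)) (𝓡 m).tangent ∞ D.incl := by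
  intro v₀
  rw [contMDiffAt_totalSpace]
  refine ⟨(contMDiff_proj D.Fib).contMDiffAt, ?_⟩
  set z₀ := v₀.proj with hz₀
  set s := (D.exists_frame z₀).choose_spec.2.2.choose
  set O := (D.exists_frame z₀).choose
  have hO : IsOpen O := (D.exists_frame z₀).choose_spec.1
  have hzO : z₀ ∈ O := (D.exists_frame z₀).choose_spec.2.1
  have h : IsFrameOn D.fiber s O := (D.exists_frame z₀).choose_spec.2.2.choose_spec
  set B := (trivializationAt (EuclideanSpace ℝ (Fin m)) (TangentSpace (𝓡 m)) z₀).baseSet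
  have hB : IsOpen B := Trivialization.open_baseSet _
  have hzB : z₀ ∈ B := FiberBundle.mem_baseSet_trivializationAt' z₀
  let e := trivializationAt (EuclideanSpace ℝ (Fin D.rank)) D.Fib z₀
  have he : ContMDiffAt ((𝓡 m).prod (𝓡 D.rank)) ((𝓡 m).prod (𝓡 D.rank)) ∞ e v₀ :=
    e.contMDiffOn.contMDiffAt (e.open_source.mem_nhds
      (e.mem_source.2 (FiberBundle.mem_baseSet_trivializationAt' z₀)))
  have hA : ContMDiffAt ((𝓡 m).prod (𝓡 D.rank))
      𝓘(ℝ, EuclideanSpace ℝ (Fin D.rank) →L[ℝ] EuclideanSpace ℝ (Fin m)) ∞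
      (fun v : D.Total => frameMatrix s z₀ v.proj) v₀ :=
    ContMDiffAt.comp (g := frameMatrix s z₀) (f := fun v : D.Total => v.proj) v₀
      ((contMDiffOn_frameMatrix hO h z₀).contMDiffAt ((hO.inter hB).mem_nhds ⟨hzO, hzB⟩))
      (contMDiff_proj D.Fib).contMDiffAt
  have hF : ContMDiffAt ((𝓡 m).prod (𝓡 D.rank)) (𝓡 m) ∞
      (fun v : D.Total => frameMatrix s z₀ v.proj (e v).2) v₀ :=
    hA.clm_apply (contMDiffAt_snd.comp v₀ he)
  refine hF.congr_of_eventuallyEq ?_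
  have hcont : ContinuousAt (TotalSpace.proj : D.Total → M) v₀ :=
    (contMDiff_proj (n := ∞) (IB := 𝓡 m) D.Fib).continuous.continuousAt
  filter_upwards [hcont.preimage_mem_nhds ((hO.inter hB).mem_nhds ⟨hzO, hzB⟩)]
  rintro ⟨z, v⟩ ⟨hz, hz'⟩
  have h1 : (e ⟨z, v⟩).2 = (h.equiv hz).symm v :=
    congrArg Prod.snd (D.framePretrivialization_apply hO h hz v)
  change _ = frameMatrix s z₀ z (e ⟨z, v⟩).2
  rw [h1, frameMatrix_apply s hz', ← h.coe_equiv hz, LinearEquiv.apply_symm_apply,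
    Trivialization.coe_linearMapAt_of_mem _ hz']
  rfl

end TangentDistribution

end Bundle

/-! ### Smooth fibrations and control systems -/

section Control

variable {EU HU U E H M E' H' N : Type*}
  [NormedAddCommGroup EU] [NormedSpace ℝ EU] [TopologicalSpace HU]
  [NormedAddCommGroup E] [NormedSpace ℝ E] [TopologicalSpace H]
  [NormedAddCommGroup E'] [NormedSpace ℝ E'] [TopologicalSpace H']
  [TopologicalSpace U] [ChartedSpace HU U]
  [TopologicalSpace M] [ChartedSpace H M]
  [TopologicalSpace N] [ChartedSpace H' N]

/-- A smooth locally trivial fibration: a smooth map `p : U → M` such that every point of `M` has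
an open neighbourhood `V` (the base set of `e`) with a diffeomorphism `e` from `p ⁻¹' V` onto
`V × F` over `V`, for a smooth finite-dimensional manifold `F`. (Fibres of a map from a
second-countable Hausdorff manifold have at most the cardinality of the continuum, so it is no
restriction to take `F` in `Type`.) -/
structure IsFibration (IU : ModelWithCorners ℝ EU HU) (I : ModelWithCorners ℝ E H)
    (p : U → M) : Prop where
  contMDiff : ContMDiff IU I ∞ p
  locallyTrivial : ∀ x : M, ∃ (k : ℕ) (F : Type) (_ : TopologicalSpace F)
    (_ : ChartedSpace (EuclideanSpace ℝ (Fin k)) F) (_ : IsManifold (𝓡 k) ∞ F)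
    (e : Trivialization F p), x ∈ e.baseSet ∧
      ContMDiffOn IU (I.prod (𝓡 k)) ∞ e e.source ∧
      ContMDiffOn (I.prod (𝓡 k)) IU ∞ e.toOpenPartialHomeomorph.symm e.target

/-- A control system `U → TM → M`: a fibration `proj : U → M` and a smooth map `F : U → TM` over
`M`. The map `F` is given by its vector component `vel u ∈ T_{proj u} M`, so that the triangle
commutes by construction. -/
structure ControlSystem (IU : ModelWithCorners ℝ EU HU) (U : Type*) [TopologicalSpace U]
    [ChartedSpace HU U] (I : ModelWithCorners ℝ E H) (M : Type*) [TopologicalSpace M]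
    [ChartedSpace H M] [IsManifold I ∞ M] where
  proj : U → M
  isFibration : IsFibration IU I proj
  vel : ∀ u : U, TangentSpace I (proj u)
  contMDiff_vel : ContMDiff IU I.tangent ∞ fun u => (⟨proj u, vel u⟩ : TangentBundle I M)

/-- An absolutely continuous curve `x : [a, b] → M` in a manifold: it is continuous, and absolutely
continuous in charts on each compact interval which it maps into the domain of a chart. -/
structure IsAbsolutelyContinuousCurve (I : ModelWithCorners ℝ E H) (x : ℝ → M) (a b : ℝ) :
    Prop where
  continuousOn : ContinuousOn x (Icc a b)
  absolutelyContinuous : ∀ (q : M) (c d : ℝ), a ≤ c → c ≤ d → d ≤ b →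
    MapsTo x (Icc c d) (chartAt H q).source →
    AbsolutelyContinuousOnInterval (fun t => extChartAt I q (x t)) c d

namespace ControlSystem

variable {IU : ModelWithCorners ℝ EU HU} {I : ModelWithCorners ℝ E H}
  {J : ModelWithCorners ℝ E' H'} [IsManifold I ∞ M] [IsManifold J ∞ N]

/-- `c : [a, b] → U` is an admissible control: it is (Lebesgue) measurable and essentially bounded,
its projection `x = proj ∘ c` is absolutely continuous, and `x'(t) = F (c t)` for almost every
`t ∈ [a, b]`. A map into a manifold is essentially bounded if it has almost all of its values in
some compact set. Values of `c` outside `[a, b]` play no role. -/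
structure IsAdmissible (C : ControlSystem IU U I M) (c : ℝ → U) (a b : ℝ) : Prop where
  aemeasurable : @AEMeasurable ℝ U (borel U) _ c (volume.restrict (Icc a b))
  essentiallyBounded : ∃ Q : Set U, IsCompact Q ∧ ∀ᵐ t ∂(volume.restrict (Icc a b)), c t ∈ Q
  absolutelyContinuous : IsAbsolutelyContinuousCurve I (fun t => C.proj (c t)) a b
  hasMFDerivAt : ∀ᵐ t ∂(volume.restrict (Icc a b)),
    HasMFDerivAt 𝓘(ℝ, ℝ) I (fun t => C.proj (c t)) t
      ((1 : ℝ →L[ℝ] ℝ).smulRight (C.vel (c t)))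

/-- `x : [a, b] → M` is a trajectory of `C`: the projection of an admissible control. -/
def IsTrajectory (C : ControlSystem IU U I M) (x : ℝ → M) (a b : ℝ) : Prop :=
  ∃ c : ℝ → U, C.IsAdmissible c a b ∧ ∀ t ∈ Icc a b, x t = C.proj (c t)

/-- `z₁` and `z₂` are joined by a trajectory of the restriction of `C` to the open set `V`, that
is, by a trajectory of `C` that stays in `V`. (Such a trajectory has compact image in `V`, so the
control is also essentially bounded in `proj ⁻¹' V`.) -/
def JoinedIn (C : ControlSystem IU U I M) (V : Set M) (z₁ z₂ : M) : Prop :=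
  ∃ (a b : ℝ) (x : ℝ → M), a < b ∧ C.IsTrajectory x a b ∧ (∀ t ∈ Icc a b, x t ∈ V) ∧
    x a = z₁ ∧ x b = z₂

/-- Local controllability at `z₀`. -/
def LocallyControllableAt (C : ControlSystem IU U I M) (z₀ : M) : Prop :=
  ∀ V : Set M, IsOpen V → z₀ ∈ V →
    ∃ W : Set M, IsOpen W ∧ z₀ ∈ W ∧ W ⊆ V ∧ ∀ z₁ ∈ W, ∀ z₂ ∈ W, C.JoinedIn V z₁ z₂

/-- The quotient of a control system on `M` by a fibration `pr : M → N`, the composition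
`U → M → N` being supposed a fibration as well. -/
def quotient (C : ControlSystem IU U I M) (pr : M → N) (hpr : IsFibration I J pr)
    (hcomp : IsFibration IU J (pr ∘ C.proj)) : ControlSystem IU U J N where
  proj := pr ∘ C.proj
  isFibration := hcomp
  vel u := mfderiv I J pr (C.proj u) (C.vel u)
  contMDiff_vel := (hpr.contMDiff.contMDiff_tangentMap (m := ∞) (by simp)).comp C.contMDiff_vel

end ControlSystem

end Control

/-! ### Pseudo-product structures -/

section PseudoProductStructure

variable {m : ℕ} {M : Type*} [TopologicalSpace M]
  [ChartedSpace (EuclideanSpace ℝ (Fin m)) M] [IsManifold (𝓡 m) ∞ M]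

namespace TangentDistribution

/-- The control system `D → TM → M` of a distribution `D`. -/
def controlSystem (D : TangentDistribution m M) :
    ControlSystem ((𝓡 m).prod (𝓡 D.rank)) D.Total (𝓡 m) M where
  proj := TotalSpace.proj
  isFibration :=
    { contMDiff := contMDiff_proj D.Fib
      locallyTrivial := fun x =>
        ⟨D.rank, EuclideanSpace ℝ (Fin D.rank), inferInstance, inferInstance, inferInstance,
          trivializationAt (EuclideanSpace ℝ (Fin D.rank)) D.Fib x,
          FiberBundle.mem_baseSet_trivializationAt' x,
          Trivialization.contMDiffOn _, Trivialization.contMDiffOn_symm _⟩ }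
  vel v := v.snd
  contMDiff_vel := D.contMDiff_incl

/-- `D` is integrable: locally it is tangent to the fibres of a submersion. -/
def IsIntegrable (D : TangentDistribution m M) : Prop :=
  ∀ z : M, ∃ (O : Set M) (q : ℕ) (f : M → EuclideanSpace ℝ (Fin q)), IsOpen O ∧ z ∈ O ∧
    ContMDiffOn (𝓡 m) (𝓡 q) ∞ f O ∧
    ∀ y ∈ O, Function.Surjective (mfderiv (𝓡 m) (𝓡 q) f y) ∧
      (mfderiv (𝓡 m) (𝓡 q) f y).ker = D.fiber y

/-- `X` is a smooth section of `D` over the open set `O`. -/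
structure IsSectionOn (D : TangentDistribution m M) (X : ∀ z : M, TangentSpace (𝓡 m) z)
    (O : Set M) : Prop where
  smooth : ContMDiffOn (𝓡 m) (𝓡 m).tangent ∞
    (fun z => (⟨z, X z⟩ : TangentBundle (𝓡 m) M)) O
  mem : ∀ z ∈ O, X z ∈ D.fiber z

/-- The iterated Lie brackets `X`, `[X₁, X]`, `[X₂, [X₁, X]]`, ... of smooth sections of `D` over
the open set `O`. (Only the values on `O` matter.) -/
inductive IsIteratedBracketOn (D : TangentDistribution m M) (O : Set M) :
    (∀ z : M, TangentSpace (𝓡 m) z) → Prop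
  | of_section (X : ∀ z : M, TangentSpace (𝓡 m) z) (hX : D.IsSectionOn X O) :
      IsIteratedBracketOn D O X
  | bracket (X Y : ∀ z : M, TangentSpace (𝓡 m) z) (hX : D.IsSectionOn X O)
      (hY : IsIteratedBracketOn D O Y) :
      IsIteratedBracketOn D O (VectorField.mlieBracket (𝓡 m) X Y)

/-- `D` is bracket generating at `z`: the iterated Lie brackets of local sections of `D` near `z`
span `T_z M`. -/
def IsBracketGeneratingAt (D : TangentDistribution m M) (z : M) : Prop :=
  Submodule.span ℝ {v : TangentSpace (𝓡 m) z | ∃ (O : Set M) (X : ∀ y : M, TangentSpace (𝓡 m) y),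
    IsOpen O ∧ z ∈ O ∧ D.IsIteratedBracketOn O X ∧ X z = v} = ⊤

/-- `D` is bracket generating near `z₀`. -/
def IsBracketGeneratingNear (D : TangentDistribution m M) (z₀ : M) : Prop :=
  ∀ᶠ z in 𝓝 z₀, D.IsBracketGeneratingAt z

end TangentDistribution

/-- A pseudo-product structure on `M`: a distribution `E` with a decomposition `E = L ⊕ K` into
integrable subbundles. -/
structure PseudoProductStructure (m : ℕ) (M : Type*) [TopologicalSpace M]
    [ChartedSpace (EuclideanSpace ℝ (Fin m)) M] [IsManifold (𝓡 m) ∞ M] where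
  E : TangentDistribution m M
  L : TangentDistribution m M
  K : TangentDistribution m M
  sup_eq : ∀ z, L.fiber z ⊔ K.fiber z = E.fiber z
  disjoint : ∀ z, Disjoint (L.fiber z) (K.fiber z)
  integrable_L : L.IsIntegrable
  integrable_K : K.IsIntegrable

end PseudoProductStructure

end

end PseudoProduct

open Bundle PseudoProduct
open scoped Manifold ContDiff

/-!
Write `E` as the span of integrable distributions `L i`, and let the class of a point be the set of
points reached from it by finitely many steps, each inside a plaque of some `L i`; since points of a
plaque are joined by smooth curves tangent to `L i`, these steps are trajectories. Among the smooth
immersions into the class of `z₀`, take one of maximal dimension at a point. Moving its image along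
the plaques cannot raise the dimension, so the image is tangent to every `L i`, hence to `E`, hence
to all iterated brackets of sections of `E`. These span, so the image is open. The relation is
symmetric and the set of points related to an open set is open, because plaques are fibres of
submersions; so openness can be transported back to `z₀`, and the class is a neighbourhood of `z₀`.
Downstairs, a step along a leaf which the fibration contracts is a constant curve, which is a
trajectory with zero control.
-/

namespace PseudoProduct

section Brackets

variable {E K : Type*} [NormedAddCommGroup E] [NormedSpace ℝ E]
  [NormedAddCommGroup K] [NormedSpace ℝ K]

theorem fderiv_apply_lieBracket_of_related {G : K → E} {X Y : E → E} {η θ : K → K} {p : K}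
    (hG : ContDiffAt ℝ 2 G p) (hX : DifferentiableAt ℝ X (G p)) (hY : DifferentiableAt ℝ Y (G p))
    (hη : DifferentiableAt ℝ η p) (hθ : DifferentiableAt ℝ θ p)
    (hηX : ∀ᶠ u in 𝓝 p, fderiv ℝ G u (η u) = X (G u))
    (hθY : ∀ᶠ u in 𝓝 p, fderiv ℝ G u (θ u) = Y (G u)) :
    fderiv ℝ G p (VectorField.lieBracket ℝ η θ p) = VectorField.lieBracket ℝ X Y (G p) := by
  have hGp : DifferentiableAt ℝ G p := hG.differentiableAt (by simp)
  have fderiv_related {Z : E → E} {ζ : K → K} (hZ : DifferentiableAt ℝ Z (G p))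
      (h : ∀ᶠ u in 𝓝 p, fderiv ℝ G u (ζ u) = Z (G u)) :
      fderiv ℝ (fun u => fderiv ℝ G u (ζ u)) p = (fderiv ℝ Z (G p)).comp (fderiv ℝ G p) := by
    rw [EventuallyEq.fderiv_eq (f := Z ∘ G) h, fderiv_comp p hZ hGp]
  rw [VectorField.fderiv_apply_lieBracket hG (by simp) hθ hη, fderiv_related hX hηX,
    fderiv_related hY hθY, VectorField.lieBracket_eq]
  simp [hηX.self_of_nhds, hθY.self_of_nhds]

/-- The iterated Lie brackets over the open set `Ω` of smooth vector fields with values in the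
family `D` of subspaces of a vector space. The constructor `congr` makes the notion depend only on
the values on `Ω`. -/
inductive IsIteratedLieBracketOn (D : E → Submodule ℝ E) (Ω : Set E) : (E → E) → Prop
  | of_section (X : E → E) (hX : ContDiffOn ℝ ∞ X Ω) (hXD : ∀ x ∈ Ω, X x ∈ D x) :
      IsIteratedLieBracketOn D Ω X
  | bracket (X Y : E → E) (hX : ContDiffOn ℝ ∞ X Ω) (hXD : ∀ x ∈ Ω, X x ∈ D x)
      (hY : IsIteratedLieBracketOn D Ω Y) :
      IsIteratedLieBracketOn D Ω (VectorField.lieBracket ℝ X Y)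
  | congr (X Y : E → E) (hX : IsIteratedLieBracketOn D Ω X) (h : EqOn X Y Ω) :
      IsIteratedLieBracketOn D Ω Y

/-- The family `D` of subspaces of a vector space is bracket generating at `x`: the iterated Lie
brackets of smooth sections of `D` near `x` span the vector space at `x`. -/
def IsLieBracketGeneratingAt (D : E → Submodule ℝ E) (x : E) : Prop :=
  Submodule.span ℝ {v | ∃ (Ω : Set E) (Y : E → E), IsOpen Ω ∧ x ∈ Ω ∧
    IsIteratedLieBracketOn D Ω Y ∧ Y x = v} = ⊤

theorem IsIteratedLieBracketOn.contDiffOn {D : E → Submodule ℝ E} {Ω : Set E} (hΩ : IsOpen Ω)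
    {Y : E → E} (hY : IsIteratedLieBracketOn D Ω Y) : ContDiffOn ℝ ∞ Y Ω := by
  induction hY with
  | of_section _ hX => exact hX
  | bracket X Y hX _ _ ihY =>
    exact fun x hx => ((hX.contDiffAt (hΩ.mem_nhds hx)).lieBracket_vectorField
      (ihY.contDiffAt (hΩ.mem_nhds hx)) (by simp)).contDiffWithinAt
  | congr _ _ _ h ihX => exact ihX.congr h.symm

theorem exists_contDiffAt_leftInverse {F : Type*} [NormedAddCommGroup F] [NormedSpace ℝ F]
    [FiniteDimensional ℝ K] [FiniteDimensional ℝ F] {A : K →L[ℝ] F}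
    (hA : Function.Injective A) :
    ∃ B : (K →L[ℝ] F) → F →L[ℝ] K, ContDiffAt ℝ ∞ B A ∧ ∀ᶠ A' in 𝓝 A, ∀ w, B A' (A' w) = w := by
  have : CompleteSpace K := FiniteDimensional.complete ℝ K
  obtain ⟨T₀, hT₀⟩ := LinearMap.exists_leftInverse_of_injective (A : K →ₗ[ℝ] F)
    (LinearMap.ker_eq_bot.2 hA)
  let T : F →L[ℝ] K := LinearMap.toContinuousLinearMap T₀
  have hTA : T.comp A = ContinuousLinearMap.id ℝ K := by
    ext1 a
    exact LinearMap.congr_fun hT₀ a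
  have hcomp : ContDiff ℝ ∞ fun A' : K →L[ℝ] F => T.comp A' := contDiff_const.clm_comp contDiff_id
  have hinv : ContDiffAt ℝ ∞ ContinuousLinearMap.inverse (T.comp A) :=
    hTA ▸ contDiffAt_map_inverse (ContinuousLinearEquiv.refl ℝ K)
  refine ⟨fun A' => (T.comp A').inverse.comp T,
    (hinv.comp A hcomp.contDiffAt).clm_comp contDiffAt_const, ?_⟩
  have hequiv : ∀ᶠ A' in 𝓝 A, T.comp A' ∈ range ((↑) : (K ≃L[ℝ] K) → K →L[ℝ] K) :=
    hcomp.continuous.continuousAt.eventually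
      (ContinuousLinearEquiv.isOpen.mem_nhds ⟨ContinuousLinearEquiv.refl ℝ K, hTA.symm⟩)
  filter_upwards [hequiv] with A' ⟨e, he⟩ w
  have hTw : T (A' w) = e w := (DFunLike.congr_fun he w).symm
  rw [ContinuousLinearMap.comp_apply, hTw, ← he, ContinuousLinearMap.inverse_equiv]
  exact e.symm_apply_apply w

theorem eventually_differentiableAt {f : K → E} {x : K} (hf : ContDiffAt ℝ ∞ f x) :
    ∀ᶠ y in 𝓝 x, DifferentiableAt ℝ f y :=
  ((hf.of_le (m := 1) (by norm_cast)).eventually (by simp)).mono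
    fun _ hy => hy.differentiableAt (by simp)

/-- The vector field `Y` is tangent near `p` to the immersed submanifold `G`: it is `G`-related to a
smooth vector field on the parameter space. -/
def IsTangentAlong (G : K → E) (Y : E → E) (p : K) : Prop :=
  ∃ η : K → K, ContDiffAt ℝ ∞ η p ∧ ∀ᶠ u in 𝓝 p, fderiv ℝ G u (η u) = Y (G u)

variable {G : K → E} {p : K}

theorem isTangentAlong_of_mem_range [FiniteDimensional ℝ E] [FiniteDimensional ℝ K]
    (hG : ContDiffAt ℝ ∞ G p) (hinj : Function.Injective (fderiv ℝ G p)) {X : E → E}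
    (hX : ContDiffAt ℝ ∞ X (G p)) (hXG : ∀ᶠ u in 𝓝 p, X (G u) ∈ (fderiv ℝ G u).range) :
    IsTangentAlong G X p := by
  have hdG : ContDiffAt ℝ ∞ (fderiv ℝ G) p := hG.fderiv_right (by simp)
  obtain ⟨B, hB, hBleft⟩ := exists_contDiffAt_leftInverse hinj
  refine ⟨fun u => B (fderiv ℝ G u) (X (G u)), (hB.comp p hdG).clm_apply (hX.comp p hG), ?_⟩
  filter_upwards [hXG, hdG.continuousAt.eventually hBleft] with u ⟨w, hw⟩ hBu
  have hw : fderiv ℝ G u w = X (G u) := hw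
  rw [← hw, hBu]

theorem IsTangentAlong.lieBracket (hG : ContDiffAt ℝ ∞ G p) {X Y : E → E}
    (hX : ContDiffAt ℝ ∞ X (G p)) (hY : ContDiffAt ℝ ∞ Y (G p))
    (hGX : IsTangentAlong G X p) (hGY : IsTangentAlong G Y p) :
    IsTangentAlong G (VectorField.lieBracket ℝ X Y) p := by
  obtain ⟨η, hη, hηX⟩ := hGX
  obtain ⟨θ, hθ, hθY⟩ := hGY
  refine ⟨VectorField.lieBracket ℝ η θ, hη.lieBracket_vectorField hθ (by simp), ?_⟩
  filter_upwards [(hG.of_le (m := 2) (by norm_cast)).eventually (by simp),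
    hG.continuousAt.eventually (eventually_differentiableAt hX),
    hG.continuousAt.eventually (eventually_differentiableAt hY),
    eventually_differentiableAt hη, eventually_differentiableAt hθ,
    hηX.eventually_nhds, hθY.eventually_nhds] with u hGu hXu hYu hηu hθu hηXu hθYu
  exact fderiv_apply_lieBracket_of_related hGu hXu hYu hηu hθu hηXu hθYu

theorem IsIteratedLieBracketOn.isTangentAlong [FiniteDimensional ℝ E] [FiniteDimensional ℝ K]
    {D : E → Submodule ℝ E} (hG : ContDiffAt ℝ ∞ G p) (hinj : Function.Injective (fderiv ℝ G p))
    (hD : ∀ᶠ u in 𝓝 p, D (G u) ≤ (fderiv ℝ G u).range) {Ω : Set E} (hΩ : IsOpen Ω)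
    (hp : G p ∈ Ω) {Y : E → E} (hY : IsIteratedLieBracketOn D Ω Y) : IsTangentAlong G Y p := by
  have hΩp : Ω ∈ 𝓝 (G p) := hΩ.mem_nhds hp
  have hGΩ : ∀ᶠ u in 𝓝 p, G u ∈ Ω := hG.continuousAt.eventually hΩp
  have of_section {X : E → E} (hX : ContDiffOn ℝ ∞ X Ω) (hXD : ∀ x ∈ Ω, X x ∈ D x) :
      IsTangentAlong G X p := by
    refine isTangentAlong_of_mem_range hG hinj (hX.contDiffAt hΩp) ?_
    filter_upwards [hGΩ, hD] with u hu hDu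
    exact hDu (hXD _ hu)
  induction hY with
  | of_section X hX hXD => exact of_section hX hXD
  | bracket X Y hX hXD hY ihY =>
    exact .lieBracket hG (hX.contDiffAt hΩp) ((hY.contDiffOn hΩ).contDiffAt hΩp)
      (of_section hX hXD) ihY
  | congr X Y _ h ihX =>
    obtain ⟨η, hη, hηX⟩ := ihX
    refine ⟨η, hη, ?_⟩
    filter_upwards [hηX, hGΩ] with u hu huΩ
    rw [hu, h huΩ]

theorem IsLieBracketGeneratingAt.range_fderiv_eq_top [FiniteDimensional ℝ E]
    [FiniteDimensional ℝ K] {D : E → Submodule ℝ E} (hbr : IsLieBracketGeneratingAt D (G p))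
    (hG : ContDiffAt ℝ ∞ G p) (hinj : Function.Injective (fderiv ℝ G p))
    (hD : ∀ᶠ u in 𝓝 p, D (G u) ≤ (fderiv ℝ G u).range) : (fderiv ℝ G p).range = ⊤ := by
  rw [eq_top_iff, ← hbr, Submodule.span_le]
  rintro v ⟨Ω, Y, hΩ, hp, hY, rfl⟩
  obtain ⟨η, -, hη⟩ := hY.isTangentAlong hG hinj hD hΩ hp
  exact ⟨η p, hη.self_of_nhds⟩

end Brackets

section Orbits

variable {E K : Type*} [NormedAddCommGroup E] [NormedSpace ℝ E]
  [NormedAddCommGroup K] [NormedSpace ℝ K] {r : E → E → Prop}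

/-- `F` is a smooth one-parameter family of local maps `y ↦ F (t, y)` near `x` which starts at the
identity, has initial velocity `v` at `x`, and moves points inside their classes for `r`. -/
structure IsMoveAt (r : E → E → Prop) (F : ℝ × E → E) (x v : E) : Prop where
  contDiffAt : ∀ᶠ q in 𝓝 ((0 : ℝ), x), ContDiffAt ℝ ∞ F q
  apply_zero : ∀ᶠ y in 𝓝 x, F (0, y) = y
  hasDerivAt : HasDerivAt (fun t => F (t, x)) v 0
  rel : ∀ᶠ q in 𝓝 ((0 : ℝ), x), r q.2 (F q)

theorem IsMoveAt.hasFDerivAt {F : ℝ × E → E} {x v : E} (hF : IsMoveAt r F x v) :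
    HasFDerivAt F ((ContinuousLinearMap.fst ℝ ℝ E).smulRight v + ContinuousLinearMap.snd ℝ ℝ E)
      (0, x) := by
  have hFd : HasFDerivAt F (fderiv ℝ F (0, x)) (0, x) :=
    (hF.contDiffAt.self_of_nhds.differentiableAt (by simp)).hasFDerivAt
  have htime : fderiv ℝ F (0, x) (1, 0) = v := by
    have := hFd.comp_hasDerivAt (0 : ℝ) ((hasDerivAt_id (0 : ℝ)).prodMk (hasDerivAt_const 0 x))
    exact this.unique hF.hasDerivAt
  have hspace : (fderiv ℝ F (0, x)).comp (ContinuousLinearMap.inr ℝ ℝ E) = .id ℝ E :=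
    (hFd.comp x (hasFDerivAt_prodMk_right 0 x)).unique
      ((hasFDerivAt_id x).congr_of_eventuallyEq hF.apply_zero)
  convert hFd using 1
  ext y
  · simp [htime]
  · simpa using (DFunLike.congr_fun hspace y).symm

/-- Near `p`, the map `G` is an immersion with values in the class of `x₀` for `r`. -/
structure IsImmersionIntoClassAt (r : E → E → Prop) (x₀ : E) (G : K → E) (p : K) : Prop where
  contDiffAt : ∀ᶠ u in 𝓝 p, ContDiffAt ℝ ∞ G u
  injective : Function.Injective (fderiv ℝ G p)
  rel : ∀ᶠ u in 𝓝 p, r x₀ (G u)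

variable {x₀ : E} {G : K → E} {p : K}

theorem IsImmersionIntoClassAt.eventually [FiniteDimensional ℝ K]
    (h : IsImmersionIntoClassAt r x₀ G p) : ∀ᶠ u in 𝓝 p, IsImmersionIntoClassAt r x₀ G u := by
  have hinj : ∀ᶠ u in 𝓝 p, Function.Injective (fderiv ℝ G u) :=
    (h.contDiffAt.self_of_nhds.fderiv_right (m := ∞) (by simp)).continuousAt.eventually
      (ContinuousLinearMap.isOpen_injective.mem_nhds h.injective)
  filter_upwards [h.contDiffAt.eventually_nhds, hinj, h.rel.eventually_nhds] with u hG hinj hr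
  exact ⟨hG, hinj, hr⟩

theorem IsImmersionIntoClassAt.prod (hr : Equivalence r) (h : IsImmersionIntoClassAt r x₀ G p)
    {F : ℝ × E → E} {v : E} (hF : IsMoveAt r F (G p) v) (hv : v ∉ (fderiv ℝ G p).range) :
    IsImmersionIntoClassAt r x₀ (fun q : K × ℝ => F (q.2, G q.1)) (p, 0) := by
  have hGp : HasFDerivAt G (fderiv ℝ G p) p :=
    (h.contDiffAt.self_of_nhds.differentiableAt (by simp)).hasFDerivAt
  have hmap : HasFDerivAt (fun q : K × ℝ => (q.2, G q.1))
      ((ContinuousLinearMap.snd ℝ K ℝ).prod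
        ((fderiv ℝ G p).comp (ContinuousLinearMap.fst ℝ K ℝ))) (p, 0) :=
    hasFDerivAt_snd.prodMk (HasFDerivAt.comp (p, (0 : ℝ)) (g := G) (by exact hGp) hasFDerivAt_fst)
  have hmap_tendsto : Tendsto (fun q : K × ℝ => (q.2, G q.1)) (𝓝 (p, 0)) (𝓝 (0, G p)) :=
    hmap.continuousAt
  have hfst : Tendsto (Prod.fst : K × ℝ → K) (𝓝 (p, 0)) (𝓝 p) := continuousAt_fst
  refine ⟨?_, ?_, ?_⟩
  · filter_upwards [hmap_tendsto.eventually hF.contDiffAt, hfst.eventually h.contDiffAt]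
      with q hFq hGq
    exact hFq.comp q (contDiffAt_snd.prodMk (hGq.comp q contDiffAt_fst))
  · have hcomp : HasFDerivAt (fun q : K × ℝ => F (q.2, G q.1)) _ (p, 0) :=
      HasFDerivAt.comp (p, (0 : ℝ)) (g := F) (by exact hF.hasFDerivAt) hmap
    rw [hcomp.fderiv, injective_iff_map_eq_zero]
    rintro ⟨w, s⟩ hws
    have hws : s • v + fderiv ℝ G p w = 0 := by simpa using hws
    obtain rfl : s = 0 := by
      by_contra hs
      refine hv ⟨-(s⁻¹ • w), ?_⟩
      simp [(neg_eq_of_add_eq_zero_right hws).symm, smul_smul, hs]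
    have hw : fderiv ℝ G p w = fderiv ℝ G p 0 := by simpa using hws
    rw [h.injective hw]
    rfl
  · filter_upwards [hmap_tendsto.eventually hF.rel, hfst.eventually h.rel] with q hFq hGq
    exact hr.trans hGq hFq

theorem exists_isImmersionIntoClassAt_max [FiniteDimensional ℝ E] (hr : Equivalence r) (x₀ : E) :
    ∃ (K : Type) (_ : NormedAddCommGroup K) (_ : NormedSpace ℝ K) (_ : FiniteDimensional ℝ K)
      (G : K → E) (p : K), IsImmersionIntoClassAt r x₀ G p ∧
      ∀ (K' : Type) [NormedAddCommGroup K'] [NormedSpace ℝ K'] [FiniteDimensional ℝ K']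
        (G' : K' → E) (p' : K'), IsImmersionIntoClassAt r x₀ G' p' →
        Module.finrank ℝ K' ≤ Module.finrank ℝ K := by
  classical
  let Q : ℕ → Prop := fun k => ∃ (K : Type) (_ : NormedAddCommGroup K) (_ : NormedSpace ℝ K)
    (_ : FiniteDimensional ℝ K) (G : K → E) (p : K), IsImmersionIntoClassAt r x₀ G p ∧
      Module.finrank ℝ K = k
  have hQ_zero : Q 0 := ⟨EuclideanSpace ℝ (Fin 0), inferInstance, inferInstance, inferInstance,
    fun _ => x₀, 0, ⟨.of_forall fun _ => contDiffAt_const, Function.injective_of_subsingleton _,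
      .of_forall fun _ => hr.refl _⟩, by simp⟩
  obtain ⟨K, _, _, _, G, p, h, hK⟩ :=
    Nat.findGreatest_spec (Nat.zero_le (Module.finrank ℝ E)) hQ_zero
  refine ⟨K, inferInstance, inferInstance, inferInstance, G, p, h, fun K' _ _ _ G' p' h' => ?_⟩
  rw [hK]
  exact Nat.le_findGreatest
    (LinearMap.finrank_le_finrank_of_injective (f := (fderiv ℝ G' p').toLinearMap) h'.injective)
    ⟨K', inferInstance, inferInstance, inferInstance, G', p', h', rfl⟩

theorem exists_nhds_subset_class [FiniteDimensional ℝ E] (hr : Equivalence r)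
    {D : E → Submodule ℝ E}
    (hmove : ∀ x, r x₀ x → D x ≤ Submodule.span ℝ {v | ∃ F, IsMoveAt r F x v})
    (hbr : ∀ x, r x₀ x → IsLieBracketGeneratingAt D x) :
    ∃ x, r x₀ x ∧ {y | r x₀ y} ∈ 𝓝 x := by
  obtain ⟨K, _, _, _, G, p, h, hmax⟩ := exists_isImmersionIntoClassAt_max hr x₀
  have : CompleteSpace E := FiniteDimensional.complete ℝ E
  have : CompleteSpace K := FiniteDimensional.complete ℝ K
  have hD : ∀ᶠ u in 𝓝 p, D (G u) ≤ (fderiv ℝ G u).range := by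
    filter_upwards [h.eventually] with u hu
    refine (hmove _ hu.rel.self_of_nhds).trans (Submodule.span_le.2 ?_)
    rintro v ⟨F, hF⟩
    by_contra hv
    have := hmax _ _ _ (hu.prod hr hF hv)
    simp at this
  have hG := h.contDiffAt.self_of_nhds
  have hGp := h.rel.self_of_nhds
  have hsurj := (hbr _ hGp).range_fderiv_eq_top hG h.injective hD
  refine ⟨G p, hGp, ?_⟩
  rw [← (hG.hasStrictFDerivAt (by simp)).map_nhds_eq_of_surj hsurj]
  exact h.rel

theorem class_mem_nhds_of_isLieBracketGeneratingAt [FiniteDimensional ℝ E] (hr : Equivalence r)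
    {D : E → Submodule ℝ E}
    (hmove : ∀ x, r x₀ x → D x ≤ Submodule.span ℝ {v | ∃ F, IsMoveAt r F x v})
    (hopen : ∀ s, IsOpen s → IsOpen {y | ∃ x ∈ s, r x y})
    (hbr : ∀ x, r x₀ x → IsLieBracketGeneratingAt D x) : {x | r x₀ x} ∈ 𝓝 x₀ := by
  obtain ⟨x, hx, hclass⟩ := exists_nhds_subset_class hr hmove hbr
  refine mem_of_superset ((hopen _ isOpen_interior).mem_nhds
    ⟨x, mem_interior_iff_mem_nhds.2 hclass, hr.symm hx⟩) ?_
  rintro z ⟨y, hy, hyz⟩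
  exact hr.trans (interior_subset hy) hyz

end Orbits

section Submersions

variable {E F : Type*} [NormedAddCommGroup E] [NormedSpace ℝ E]
  [NormedAddCommGroup F] [NormedSpace ℝ F]

theorem exists_smooth_openPartialHomeomorph [CompleteSpace E] {g : E → F} {O : Set E}
    (hO : IsOpen O) (hg : ContDiffOn ℝ ∞ g O) {x₀ : E} (hx₀ : x₀ ∈ O)
    (hinv : (fderiv ℝ g x₀).IsInvertible) :
    ∃ ψ : OpenPartialHomeomorph E F, x₀ ∈ ψ.source ∧ ψ.source ⊆ O ∧ ⇑ψ = g ∧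
      ContDiffOn ℝ ∞ ψ.symm ψ.target := by
  have hgO : ∀ x ∈ O, ContDiffAt ℝ ∞ g x := fun x hx => hg.contDiffAt (hO.mem_nhds hx)
  obtain ⟨e, he⟩ := hinv
  have hg' : HasFDerivAt g (e : E →L[ℝ] F) x₀ :=
    he ▸ ((hgO x₀ hx₀).differentiableAt (by simp)).hasFDerivAt
  let Φ := (hgO x₀ hx₀).toOpenPartialHomeomorph g hg' (by simp)
  have hinv : ∀ᶠ x in 𝓝 x₀, fderiv ℝ g x ∈ range ((↑) : (E ≃L[ℝ] F) → E →L[ℝ] F) :=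
    ((hgO x₀ hx₀).fderiv_right (m := ∞) (by simp)).continuousAt.eventually
      (ContinuousLinearEquiv.isOpen.mem_nhds ⟨e, he⟩)
  obtain ⟨O', hO', hO'_open, hx₀'⟩ := eventually_nhds_iff.1 (hinv.and (hO.mem_nhds hx₀))
  refine ⟨Φ.restrOpen O' hO'_open,
    ⟨(hgO x₀ hx₀).mem_toOpenPartialHomeomorph_source hg' (by simp), hx₀'⟩,
    fun x hx => (hO' x hx.2).2, rfl, fun y hy => ContDiffAt.contDiffWithinAt ?_⟩
  have hyO' : (Φ.restrOpen O' hO'_open).symm y ∈ O' := ((Φ.restrOpen O' hO'_open).map_target hy).2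
  obtain ⟨⟨e', he'⟩, hyO⟩ := hO' _ hyO'
  refine (Φ.restrOpen O' hO'_open).contDiffAt_symm (f₀' := e') hy ?_ (hgO _ hyO)
  rw [he']
  exact ((hgO _ hyO).differentiableAt (by simp)).hasFDerivAt

theorem isMoveAt_symm_add_smul {ψ : OpenPartialHomeomorph E F} (hψ : ContDiffOn ℝ ∞ ψ ψ.source)
    (hψs : ContDiffOn ℝ ∞ ψ.symm ψ.target) {x : E} (hx : x ∈ ψ.source) {r : E → E → Prop} {v : E}
    (hr : ∀ y ∈ ψ.source, ∀ t : ℝ, ψ y + t • fderiv ℝ ψ x v ∈ ψ.target →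
      r y (ψ.symm (ψ y + t • fderiv ℝ ψ x v))) :
    IsMoveAt r (fun q => ψ.symm (ψ q.2 + q.1 • fderiv ℝ ψ x v)) x v := by
  have hψ' : ∀ y ∈ ψ.source, ContDiffAt ℝ ∞ ψ y :=
    fun y hy => hψ.contDiffAt (ψ.open_source.mem_nhds hy)
  have hψs' : ∀ y ∈ ψ.target, ContDiffAt ℝ ∞ ψ.symm y :=
    fun y hy => hψs.contDiffAt (ψ.open_target.mem_nhds hy)
  have hψd : HasFDerivAt ψ (fderiv ℝ ψ x) x := ((hψ' x hx).differentiableAt (by simp)).hasFDerivAt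
  have hsource : ∀ᶠ y in 𝓝 x, y ∈ ψ.source := ψ.open_source.mem_nhds hx
  have hsource' : ∀ᶠ q in 𝓝 ((0 : ℝ), x), q.2 ∈ ψ.source := continuousAt_snd.eventually hsource
  have htarget : ∀ᶠ q in 𝓝 ((0 : ℝ), x), ψ q.2 + q.1 • fderiv ℝ ψ x v ∈ ψ.target := by
    have hcont : ContinuousAt (fun q : ℝ × E => ψ q.2 + q.1 • fderiv ℝ ψ x v) (0, x) :=
      (hψd.continuousAt.comp (f := Prod.snd) (x := ((0 : ℝ), x)) continuousAt_snd).add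
        (by fun_prop)
    exact hcont.eventually (ψ.open_target.mem_nhds (by simpa using ψ.map_source hx))
  refine ⟨?_, hsource.mono fun y hy => by simp [ψ.left_inv hy], ?_,
    (hsource'.and htarget).mono fun q hq => hr _ hq.1 _ hq.2⟩
  · filter_upwards [hsource', htarget] with q hqs hqt
    exact (hψs' _ hqt).comp q (((hψ' _ hqs).comp q contDiffAt_snd).add
      (contDiffAt_fst.smul contDiffAt_const))
  · have hψsd := ((hψs' _ (ψ.map_source hx)).differentiableAt (by simp)).hasFDerivAt
    have hsymm : fderiv ℝ ψ.symm (ψ x) (fderiv ℝ ψ x v) = v :=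
      DFunLike.congr_fun ((hψsd.comp x hψd).unique ((hasFDerivAt_id x).congr_of_eventuallyEq
        (hsource.mono fun y hy => ψ.left_inv hy))) v
    have hline : HasDerivAt (fun t : ℝ => ψ x + t • fderiv ℝ ψ x v) (fderiv ℝ ψ x v) 0 := by
      simpa using ((hasDerivAt_id (0 : ℝ)).smul_const (fderiv ℝ ψ x v)).const_add (ψ x)
    have hcomp := HasFDerivAt.comp_hasDerivAt (0 : ℝ) (l := ψ.symm) (by simpa using hψsd) hline
    rw [hsymm] at hcomp
    exact hcomp

/-- The map `f` is a smooth submersion on the open set `O` of a normed space. -/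
structure IsSubmersionOn (f : E → F) (O : Set E) : Prop where
  isOpen : IsOpen O
  contDiffOn : ContDiffOn ℝ ∞ f O
  surjective : ∀ x ∈ O, Function.Surjective (fderiv ℝ f x)

namespace IsSubmersionOn

variable [CompleteSpace E] [FiniteDimensional ℝ F] {f : E → F} {O : Set E} {x : E}

theorem exists_straightening (h : IsSubmersionOn f O) (hx : x ∈ O) :
    ∃ ψ : OpenPartialHomeomorph E (F × (fderiv ℝ f x).ker), x ∈ ψ.source ∧ ψ.source ⊆ O ∧
      (∀ y, (ψ y).1 = f y) ∧ ContDiffOn ℝ ∞ ψ ψ.source ∧ ContDiffOn ℝ ∞ ψ.symm ψ.target := by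
  have : CompleteSpace F := FiniteDimensional.complete ℝ F
  have hker := (fderiv ℝ f x).ker_closedComplemented_of_finiteDimensional_range
  let φ := HasStrictFDerivAt.implicitFunctionDataOfComplemented f (fderiv ℝ f x)
    ((h.contDiffOn.contDiffAt (h.isOpen.mem_nhds hx)).hasStrictFDerivAt (by simp))
    (LinearMap.range_eq_top.2 (h.surjective x hx)) hker
  have hφ : ContDiffOn ℝ ∞ φ.prodFun O := h.contDiffOn.prodMk
    ((Classical.choose hker).contDiff.comp (contDiff_id.sub contDiff_const)).contDiffOn
  obtain ⟨ψ, hxψ, hψO, hψ, hψs⟩ :=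
    exists_smooth_openPartialHomeomorph h.isOpen hφ hx φ.isInvertible_fderiv_prodFun
  exact ⟨ψ, hxψ, hψO, fun y => by rw [hψ]; rfl, hψ ▸ hφ.mono hψO, hψs⟩

theorem exists_isMoveAt_of_mem_ker (h : IsSubmersionOn f O) (hx : x ∈ O) {r : E → E → Prop}
    (hr : ∀ y ∈ O, ∀ z ∈ O, f y = f z → r y z) {v : E} (hv : fderiv ℝ f x v = 0) :
    ∃ F, IsMoveAt r F x v := by
  obtain ⟨ψ, hxψ, hψO, hψf, hψ, hψs⟩ := h.exists_straightening hx
  have hψ_fst : (fderiv ℝ ψ x v).1 = 0 := by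
    have hψd : HasFDerivAt ψ (fderiv ℝ ψ x) x :=
      ((hψ.contDiffAt (ψ.open_source.mem_nhds hxψ)).differentiableAt (by simp)).hasFDerivAt
    have hfst : HasFDerivAt f ((ContinuousLinearMap.fst ℝ _ _).comp (fderiv ℝ ψ x)) x :=
      hψd.fst.congr_of_eventuallyEq (.of_forall fun y => (hψf y).symm)
    exact (DFunLike.congr_fun hfst.fderiv v).symm.trans hv
  refine ⟨_, isMoveAt_symm_add_smul hψ hψs hxψ fun y hy t ht => ?_⟩
  refine hr _ (hψO hy) _ (hψO (ψ.map_target ht)) ?_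
  rw [← hψf (ψ.symm _), ψ.right_inv ht, ← hψf]
  simp [hψ_fst]

theorem exists_nhds_forall_fibre_path (h : IsSubmersionOn f O) (hx : x ∈ O) {U : Set E}
    (hU : U ∈ 𝓝 x) :
    ∃ O' ∈ 𝓝 x, ∀ y ∈ O', ∀ z ∈ O', f y = f z → ∃ γ : ℝ → E, ContDiff ℝ ∞ γ ∧ γ 0 = y ∧ γ 1 = z ∧
      ∀ t, γ t ∈ U ∧ f (γ t) = f y := by
  obtain ⟨ψ, hxψ, -, hψf, -, hψs⟩ := h.exists_straightening hx
  have hψx : ContinuousAt ψ x := ψ.continuousAt hxψ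
  have hU' : ψ.target ∩ ψ.symm ⁻¹' U ∈ 𝓝 (ψ x) :=
    inter_mem (ψ.open_target.mem_nhds (ψ.map_source hxψ))
      ((ψ.continuousAt_symm (ψ.map_source hxψ)).preimage_mem_nhds (by rwa [ψ.left_inv hxψ]))
  obtain ⟨ε, hε, hball⟩ := Metric.mem_nhds_iff.1 hU'
  refine ⟨ψ.source ∩ ψ ⁻¹' Metric.ball (ψ x) ε, inter_mem (ψ.open_source.mem_nhds hxψ)
    (hψx.preimage_mem_nhds (Metric.ball_mem_nhds _ hε)), ?_⟩
  rintro y ⟨hyψ, hy⟩ z ⟨hzψ, hz⟩ hyz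
  let β : ℝ → F × (fderiv ℝ f x).ker := fun t => ψ y + Real.smoothTransition t • (ψ z - ψ y)
  have hβ : ContDiff ℝ ∞ β := contDiff_const.add
    (Real.smoothTransition.contDiff.smul contDiff_const)
  have hβ_mem (t : ℝ) : β t ∈ ψ.target ∩ ψ.symm ⁻¹' U :=
    hball ((convex_ball _ _).add_smul_sub_mem hy hz
      ⟨Real.smoothTransition.nonneg t, Real.smoothTransition.le_one t⟩)
  refine ⟨ψ.symm ∘ β, hψs.comp_contDiff hβ fun t => (hβ_mem t).1, ?_, ?_,
    fun t => ⟨(hβ_mem t).2, ?_⟩⟩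
  · simp [β, ψ.left_inv hyψ]
  · simp [β, ψ.left_inv hzψ]
  · rw [← hψf, Function.comp_apply, ψ.right_inv (hβ_mem t).1, ← hψf y]
    simp [β, hψf, hyz]

theorem isOpen_image (h : IsSubmersionOn f O) {s : Set E} (hs : IsOpen s) (hsO : s ⊆ O) :
    IsOpen (f '' s) := by
  have : CompleteSpace F := FiniteDimensional.complete ℝ F
  rw [isOpen_iff_mem_nhds]
  rintro _ ⟨y, hy, rfl⟩
  have hf : HasStrictFDerivAt f (fderiv ℝ f y) y :=
    (h.contDiffOn.contDiffAt (h.isOpen.mem_nhds (hsO hy))).hasStrictFDerivAt (by simp)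
  rw [← hf.map_nhds_eq_of_surj (LinearMap.range_eq_top.2 (h.surjective y (hsO hy)))]
  exact image_mem_map (hs.mem_nhds hy)

end IsSubmersionOn

theorem isOpen_setOf_reflTransGen {X : Type*} [TopologicalSpace X] {r : X → X → Prop}
    (hr : ∀ s, IsOpen s → IsOpen {y | ∃ x ∈ s, r x y}) {s : Set X} (hs : IsOpen s) :
    IsOpen {y | ∃ x ∈ s, Relation.ReflTransGen r x y} := by
  rw [isOpen_iff_mem_nhds]
  rintro y ⟨x, hx, hxy⟩
  induction hxy with
  | refl => exact mem_of_superset (hs.mem_nhds hx) fun x' hx' => ⟨x', hx', .refl⟩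
  | tail _ hbc ih =>
    refine mem_of_superset
      ((hr _ isOpen_interior).mem_nhds ⟨_, mem_interior_iff_mem_nhds.2 ih, hbc⟩) ?_
    rintro c' ⟨b', hb', hbc'⟩
    obtain ⟨x', hx', hxb'⟩ := interior_subset hb'
    exact ⟨x', hx', hxb'.tail hbc'⟩

/-- The points `x` and `y` lie on a common plaque, i.e. a fibre of one of the maps `f i` restricted
to its domain `O i`. -/
def SamePlaque {X ι : Type*} {F : ι → Type*} (f : ∀ i, X → F i) (O : ι → Set X) (x y : X) : Prop :=
  ∃ i, x ∈ O i ∧ y ∈ O i ∧ f i x = f i y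

theorem equivalence_reflTransGen_samePlaque {X ι : Type*} {F : ι → Type*} (f : ∀ i, X → F i)
    (O : ι → Set X) : Equivalence (Relation.ReflTransGen (SamePlaque f O)) := by
  have : Std.Symm (SamePlaque f O) := ⟨fun _ _ ⟨i, hx, hy, hxy⟩ => ⟨i, hy, hx, hxy.symm⟩⟩
  exact ⟨fun _ => .refl, fun h => Std.Symm.symm _ _ h, fun h h' => h.trans h'⟩

variable {ι : Type*} {F : ι → Type*} [∀ i, NormedAddCommGroup (F i)] [∀ i, NormedSpace ℝ (F i)]
  {f : ∀ i, E → F i} {O : ι → Set E}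

theorem isOpen_setOf_samePlaque [CompleteSpace E] [∀ i, FiniteDimensional ℝ (F i)]
    (hf : ∀ i, IsSubmersionOn (f i) (O i)) {s : Set E} (hs : IsOpen s) :
    IsOpen {y | ∃ x ∈ s, SamePlaque f O x y} := by
  have heq : {y | ∃ x ∈ s, SamePlaque f O x y} = ⋃ i, O i ∩ f i ⁻¹' (f i '' (s ∩ O i)) := by
    ext y
    simp only [SamePlaque, mem_ofPred_eq, mem_iUnion, mem_inter_iff, mem_preimage, mem_image]
    exact ⟨fun ⟨x, hxs, i, hx, hy, hxy⟩ => ⟨i, hy, x, ⟨hxs, hx⟩, hxy⟩,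
      fun ⟨i, hy, x, ⟨hxs, hx⟩, hxy⟩ => ⟨x, hxs, i, hx, hy, hxy⟩⟩
  rw [heq]
  exact isOpen_iUnion fun i => (hf i).contDiffOn.continuousOn.isOpen_inter_preimage (hf i).isOpen
    ((hf i).isOpen_image (hs.inter (hf i).isOpen) inter_subset_right)

theorem setOf_reflTransGen_samePlaque_mem_nhds [FiniteDimensional ℝ E]
    [∀ i, FiniteDimensional ℝ (F i)] (hf : ∀ i, IsSubmersionOn (f i) (O i)) {x₀ : E}
    {D : E → Submodule ℝ E}
    (hD : ∀ x, Relation.ReflTransGen (SamePlaque f O) x₀ x →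
      D x ≤ ⨆ (i) (_ : x ∈ O i), (fderiv ℝ (f i) x).ker)
    (hbr : ∀ x, Relation.ReflTransGen (SamePlaque f O) x₀ x → IsLieBracketGeneratingAt D x) :
    {x | Relation.ReflTransGen (SamePlaque f O) x₀ x} ∈ 𝓝 x₀ := by
  have : CompleteSpace E := FiniteDimensional.complete ℝ E
  refine class_mem_nhds_of_isLieBracketGeneratingAt (equivalence_reflTransGen_samePlaque f O)
    (fun x hx => (hD x hx).trans (iSup₂_le fun i hxi v hv => Submodule.subset_span ?_))
    (fun s hs => isOpen_setOf_reflTransGen (fun _ => isOpen_setOf_samePlaque hf) hs) hbr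
  exact (hf i).exists_isMoveAt_of_mem_ker hxi
    (fun y hy z hz hyz => .single ⟨i, hy, hz, hyz⟩) hv

end Submersions

section Coordinates

variable {m : ℕ} {M : Type*} [TopologicalSpace M]
  [ChartedSpace (EuclideanSpace ℝ (Fin m)) M]

/-- The inverse of the preferred chart at `z₀`. -/
noncomputable abbrev chartInv (z₀ : M) : EuclideanSpace ℝ (Fin m) → M := (extChartAt (𝓡 m) z₀).symm

/-- The differential of the inverse of the preferred chart at `z₀`. -/
noncomputable abbrev chartInvDeriv (z₀ : M) (ξ : EuclideanSpace ℝ (Fin m)) :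
    EuclideanSpace ℝ (Fin m) →L[ℝ] TangentSpace (𝓡 m) (chartInv z₀ ξ) :=
  mfderiv (𝓡 m) (𝓡 m) (chartInv z₀) ξ

theorem isOpen_chartInv_preimage (z₀ : M) {O : Set M} (hO : IsOpen O) :
    IsOpen ((extChartAt (𝓡 m) z₀).target ∩ chartInv z₀ ⁻¹' O) :=
  (continuousOn_extChartAt_symm z₀).isOpen_inter_preimage (isOpen_extChartAt_target z₀) hO

variable [IsManifold (𝓡 m) ∞ M] {z₀ : M} {ξ : EuclideanSpace ℝ (Fin m)}

theorem contMDiffAt_chartInv (hξ : ξ ∈ (extChartAt (𝓡 m) z₀).target) :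
    ContMDiffAt (𝓡 m) (𝓡 m) ∞ (chartInv z₀) ξ :=
  (contMDiffOn_extChartAt_symm z₀).contMDiffAt ((isOpen_extChartAt_target z₀).mem_nhds hξ)

theorem isInvertible_chartInvDeriv (hξ : ξ ∈ (extChartAt (𝓡 m) z₀).target) :
    (chartInvDeriv z₀ ξ).IsInvertible := by
  have := isInvertible_mfderivWithin_extChartAt_symm (I := 𝓡 m) hξ
  rwa [ModelWithCorners.range_eq_univ, mfderivWithin_univ] at this

/-- The vector field `X` read in the preferred chart at `z₀`. -/
noncomputable def coordField (z₀ : M) (X : ∀ z : M, TangentSpace (𝓡 m) z) :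
    EuclideanSpace ℝ (Fin m) → EuclideanSpace ℝ (Fin m) :=
  VectorField.mpullback (𝓡 m) (𝓡 m) (chartInv z₀) X

theorem chartInvDeriv_coordField (X : ∀ z : M, TangentSpace (𝓡 m) z)
    (hξ : ξ ∈ (extChartAt (𝓡 m) z₀).target) :
    chartInvDeriv z₀ ξ (coordField z₀ X ξ) = X (chartInv z₀ ξ) :=
  (isInvertible_chartInvDeriv hξ).self_apply_inverse _

theorem contDiffOn_coordField {O : Set M} (hO : IsOpen O) {X : ∀ z : M, TangentSpace (𝓡 m) z}
    (hX : ContMDiffOn (𝓡 m) (𝓡 m).tangent ∞ (fun z => (⟨z, X z⟩ : TangentBundle (𝓡 m) M)) O) :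
    ContDiffOn ℝ ∞ (coordField z₀ X) ((extChartAt (𝓡 m) z₀).target ∩ chartInv z₀ ⁻¹' O) := by
  rintro ξ ⟨hξ, hξO⟩
  have hpullback := ContMDiffAt.mpullback_vectorField_preimage (m := ∞) (n := ∞)
    (hX.contMDiffAt (hO.mem_nhds hξO)) (contMDiffAt_chartInv hξ) (isInvertible_chartInvDeriv hξ)
    (by simp)
  have hsnd := (contMDiff_snd_tangentBundle_modelSpace (n := ∞)
    (EuclideanSpace ℝ (Fin m)) (𝓡 m)).contMDiffAt.comp ξ hpullback
  exact (contMDiffAt_iff_contDiffAt.1 hsnd).contDiffWithinAt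

theorem coordField_mlieBracket {X Y : ∀ z : M, TangentSpace (𝓡 m) z}
    (hξ : ξ ∈ (extChartAt (𝓡 m) z₀).target)
    (hX : MDifferentiableAt (𝓡 m) (𝓡 m).tangent
      (fun z => (⟨z, X z⟩ : TangentBundle (𝓡 m) M)) (chartInv z₀ ξ))
    (hY : MDifferentiableAt (𝓡 m) (𝓡 m).tangent
      (fun z => (⟨z, Y z⟩ : TangentBundle (𝓡 m) M)) (chartInv z₀ ξ)) :
    coordField z₀ (VectorField.mlieBracket (𝓡 m) X Y) ξ =
      VectorField.lieBracket ℝ (coordField z₀ X) (coordField z₀ Y) ξ := by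
  have : IsManifold (𝓡 m) (minSmoothness ℝ 2) M := by
    rw [minSmoothness_of_isRCLikeNormedField]
    infer_instance
  refine (VectorField.mpullback_mlieBracket (n := ∞) hX hY (contMDiffAt_chartInv hξ)
    (by rw [minSmoothness_of_isRCLikeNormedField]; norm_cast)).trans ?_
  rw [← VectorField.mlieBracketWithin_univ, VectorField.mlieBracketWithin_eq_lieBracketWithin]
  exact congrFun VectorField.lieBracketWithin_univ ξ

namespace TangentDistribution

variable {D : TangentDistribution m M}

theorem IsIteratedBracketOn.contMDiffOn {O : Set M} (hO : IsOpen O)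
    {Y : ∀ z : M, TangentSpace (𝓡 m) z} (hY : D.IsIteratedBracketOn O Y) :
    ContMDiffOn (𝓡 m) (𝓡 m).tangent ∞ (fun z => (⟨z, Y z⟩ : TangentBundle (𝓡 m) M)) O := by
  induction hY with
  | of_section X hX => exact hX.smooth
  | bracket X Y hX _ ih =>
    have : IsManifold (𝓡 m) (minSmoothness ℝ 2) M := by
      rw [minSmoothness_of_isRCLikeNormedField]
      infer_instance
    have : IsManifold (𝓡 m) (((⊤ : ℕ∞) : WithTop ℕ∞) + 1) M := ‹IsManifold (𝓡 m) ∞ M›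
    exact fun z hz => (ContMDiffAt.mlieBracket_vectorField (n := ⊤) (m := ⊤)
      (hX.smooth.contMDiffAt (hO.mem_nhds hz)) (ih.contMDiffAt (hO.mem_nhds hz))
      (by simp)).contMDiffWithinAt

/-- The distribution `D` read in the preferred chart at `z₀`. -/
noncomputable def coord (D : TangentDistribution m M) (z₀ : M) (ξ : EuclideanSpace ℝ (Fin m)) :
    Submodule ℝ (EuclideanSpace ℝ (Fin m)) :=
  (D.fiber (chartInv z₀ ξ)).comap (chartInvDeriv z₀ ξ).toLinearMap

theorem coord_le_iSup {ι : Type*} {L : ι → TangentDistribution m M}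
    (hξ : ξ ∈ (extChartAt (𝓡 m) z₀).target)
    (h : D.fiber (chartInv z₀ ξ) ≤ ⨆ i, (L i).fiber (chartInv z₀ ξ)) :
    D.coord z₀ ξ ≤ ⨆ i, (L i).coord z₀ ξ := by
  obtain ⟨e, he⟩ := isInvertible_chartInvDeriv hξ
  have coord_eq_map (D' : TangentDistribution m M) :
      D'.coord z₀ ξ = (D'.fiber (chartInv z₀ ξ)).map e.toLinearEquiv.symm.toLinearMap := by
    rw [coord, ← he]
    exact Submodule.comap_equiv_eq_map_symm e.toLinearEquiv _
  simp only [coord_eq_map, ← Submodule.map_iSup]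
  exact Submodule.map_mono h

theorem IsSectionOn.coordField_mem {O : Set M} {X : ∀ z : M, TangentSpace (𝓡 m) z}
    (hX : D.IsSectionOn X O) (hξ : ξ ∈ (extChartAt (𝓡 m) z₀).target ∩ chartInv z₀ ⁻¹' O) :
    coordField z₀ X ξ ∈ D.coord z₀ ξ := by
  change chartInvDeriv z₀ ξ (coordField z₀ X ξ) ∈ D.fiber (chartInv z₀ ξ)
  rw [chartInvDeriv_coordField X hξ.1]
  exact hX.mem _ hξ.2

theorem IsIteratedBracketOn.coord {O : Set M} (hO : IsOpen O) (z₀ : M)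
    {Y : ∀ z : M, TangentSpace (𝓡 m) z} (hY : D.IsIteratedBracketOn O Y) :
    IsIteratedLieBracketOn (D.coord z₀) ((extChartAt (𝓡 m) z₀).target ∩ chartInv z₀ ⁻¹' O)
      (coordField z₀ Y) := by
  induction hY with
  | of_section X hX =>
    exact .of_section _ (contDiffOn_coordField hO hX.smooth) fun ξ hξ => hX.coordField_mem hξ
  | bracket X Y hX hY ih =>
    refine .congr _ _ (.bracket _ _ (contDiffOn_coordField hO hX.smooth)
      (fun ξ hξ => hX.coordField_mem hξ) ih) fun ξ hξ => (coordField_mlieBracket hξ.1 ?_ ?_).symm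
    · exact (hX.smooth.contMDiffAt (hO.mem_nhds hξ.2)).mdifferentiableAt (by simp)
    · exact ((hY.contMDiffOn hO).contMDiffAt (hO.mem_nhds hξ.2)).mdifferentiableAt (by simp)

theorem IsBracketGeneratingAt.coord (hξ : ξ ∈ (extChartAt (𝓡 m) z₀).target)
    (h : D.IsBracketGeneratingAt (chartInv z₀ ξ)) :
    IsLieBracketGeneratingAt (D.coord z₀) ξ := by
  obtain ⟨e, he⟩ := isInvertible_chartInvDeriv hξ
  refine (Submodule.map_eq_top_iff (e := e.toLinearEquiv)).1
    (eq_top_iff.2 (h ▸ Submodule.span_le.2 ?_))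
  rintro _ ⟨O, X, hO, hξO, hX, rfl⟩
  refine ⟨coordField z₀ X ξ, Submodule.subset_span
    ⟨_, _, isOpen_chartInv_preimage z₀ hO, ⟨hξ, hξO⟩, hX.coord hO z₀, rfl⟩, ?_⟩
  rw [← chartInvDeriv_coordField X hξ, ← he]
  rfl

theorem IsIntegrable.exists_isSubmersionOn_coord (hD : D.IsIntegrable)
    (hξ : ξ ∈ (extChartAt (𝓡 m) z₀).target) :
    ∃ (q : ℕ) (f : EuclideanSpace ℝ (Fin m) → EuclideanSpace ℝ (Fin q))
      (O : Set (EuclideanSpace ℝ (Fin m))), ξ ∈ O ∧ O ⊆ (extChartAt (𝓡 m) z₀).target ∧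
      IsSubmersionOn f O ∧ ∀ η ∈ O, (fderiv ℝ f η).ker = D.coord z₀ η := by
  obtain ⟨O, q, f, hO, hξO, hf, hd⟩ := hD (chartInv z₀ ξ)
  have hfO (η : EuclideanSpace ℝ (Fin m)) (hη : chartInv z₀ η ∈ O) :
      ContMDiffAt (𝓡 m) (𝓡 q) ∞ f (chartInv z₀ η) := hf.contMDiffAt (hO.mem_nhds hη)
  have fderiv_comp_chartInv (η : EuclideanSpace ℝ (Fin m))
      (hη : η ∈ (extChartAt (𝓡 m) z₀).target ∩ chartInv z₀ ⁻¹' O) :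
      fderiv ℝ (f ∘ chartInv z₀) η =
        (mfderiv (𝓡 m) (𝓡 q) f (chartInv z₀ η)).comp (chartInvDeriv z₀ η) := by
    rw [← mfderiv_eq_fderiv]
    exact mfderiv_comp η ((hfO η hη.2).mdifferentiableAt (by simp))
      ((contMDiffAt_chartInv hη.1).mdifferentiableAt (by simp))
  refine ⟨q, f ∘ chartInv z₀, (extChartAt (𝓡 m) z₀).target ∩ chartInv z₀ ⁻¹' O, ⟨hξ, hξO⟩,
    inter_subset_left, ⟨isOpen_chartInv_preimage z₀ hO, fun η hη => ?_, fun η hη => ?_⟩,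
    fun η hη => ?_⟩
  · exact (contMDiffAt_iff_contDiffAt.1
      ((hfO η hη.2).comp η (contMDiffAt_chartInv hη.1))).contDiffWithinAt
  · rw [fderiv_comp_chartInv η hη]
    exact (hd _ hη.2).1.comp (isInvertible_chartInvDeriv hη.1).surjective
  · rw [fderiv_comp_chartInv η hη, coord, ← (hd _ hη.2).2]
    rfl

end TangentDistribution

end Coordinates

section LocalTransitivity

variable {m : ℕ} {M : Type*} [TopologicalSpace M]
  [ChartedSpace (EuclideanSpace ℝ (Fin m)) M] [IsManifold (𝓡 m) ∞ M]

namespace TangentDistribution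

/-- `x` and `y` are joined by a smooth curve in `V` tangent to the distribution `D`. -/
def SmoothlyJoinedIn (D : TangentDistribution m M) (V : Set M) (x y : M) : Prop :=
  ∃ γ : ℝ → M, ContMDiff 𝓘(ℝ, ℝ) (𝓡 m) ∞ γ ∧ γ 0 = x ∧ γ 1 = y ∧
    ∀ t, γ t ∈ V ∧ mfderiv 𝓘(ℝ, ℝ) (𝓡 m) γ t (1 : ℝ) ∈ D.fiber (γ t)

variable {D : TangentDistribution m M} {V : Set M} {z₀ : M} {ξ : EuclideanSpace ℝ (Fin m)}

theorem SmoothlyJoinedIn.refl (D : TangentDistribution m M) {x : M} (hx : x ∈ V) :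
    D.SmoothlyJoinedIn V x x :=
  ⟨fun _ => x, contMDiff_const, rfl, rfl, fun t => ⟨hx, by
    rw [mfderiv_const]
    exact zero_mem _⟩⟩

theorem SmoothlyJoinedIn.of_coord {γ : ℝ → EuclideanSpace ℝ (Fin m)} (hγ : ContDiff ℝ ∞ γ)
    (hγV : ∀ t, γ t ∈ (extChartAt (𝓡 m) z₀).target ∩ chartInv z₀ ⁻¹' V)
    (hγD : ∀ t, deriv γ t ∈ D.coord z₀ (γ t)) :
    D.SmoothlyJoinedIn V (chartInv z₀ (γ 0)) (chartInv z₀ (γ 1)) := by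
  refine ⟨chartInv z₀ ∘ γ, fun t => (contMDiffAt_chartInv (hγV t).1).comp t (hγ.contMDiff t),
    rfl, rfl, fun t => ⟨(hγV t).2, ?_⟩⟩
  rw [mfderiv_comp t ((contMDiffAt_chartInv (hγV t).1).mdifferentiableAt (by simp))
    (hγ.contMDiff.mdifferentiableAt (by simp)), mfderiv_eq_fderiv]
  exact hγD t

theorem IsIntegrable.exists_plaqueChart (hD : D.IsIntegrable)
    {Ω : Set (EuclideanSpace ℝ (Fin m))} (hΩ : IsOpen Ω)
    (hΩV : Ω ⊆ (extChartAt (𝓡 m) z₀).target ∩ chartInv z₀ ⁻¹' V) (hξ : ξ ∈ Ω) :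
    ∃ (q : ℕ) (f : EuclideanSpace ℝ (Fin m) → EuclideanSpace ℝ (Fin q))
      (O : Set (EuclideanSpace ℝ (Fin m))), ξ ∈ O ∧ O ⊆ Ω ∧ IsSubmersionOn f O ∧
      (∀ η ∈ O, (fderiv ℝ f η).ker = D.coord z₀ η) ∧
      ∀ η ∈ O, ∀ ζ ∈ O, f η = f ζ → D.SmoothlyJoinedIn V (chartInv z₀ η) (chartInv z₀ ζ) := by
  obtain ⟨q, f, O, hξO, -, hf, hker⟩ := hD.exists_isSubmersionOn_coord (hΩV hξ).1
  have hOΩ : IsOpen (O ∩ Ω) := hf.isOpen.inter hΩ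
  obtain ⟨O', hO', hpath⟩ := hf.exists_nhds_forall_fibre_path hξO (hOΩ.mem_nhds ⟨hξO, hξ⟩)
  have hsub : interior O' ∩ (O ∩ Ω) ⊆ O := fun η hη => hη.2.1
  refine ⟨q, f, interior O' ∩ (O ∩ Ω), ⟨mem_interior_iff_mem_nhds.2 hO', hξO, hξ⟩,
    fun η hη => hη.2.2, ⟨isOpen_interior.inter hOΩ, hf.contDiffOn.mono hsub,
      fun η hη => hf.surjective η (hsub hη)⟩, fun η hη => hker η (hsub hη), ?_⟩
  rintro η hη ζ hζ hηζ
  obtain ⟨γ, hγ, rfl, rfl, hγf⟩ :=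
    hpath η (interior_subset hη.1) ζ (interior_subset hζ.1) hηζ
  refine .of_coord hγ (fun t => hΩV (hγf t).1.2) fun t => ?_
  have hfγ : DifferentiableAt ℝ f (γ t) :=
    (hf.contDiffOn.contDiffAt (hf.isOpen.mem_nhds (hγf t).1.1)).differentiableAt (by simp)
  have hconst : f ∘ γ = fun _ => f (γ 0) := funext fun s => (hγf s).2
  have hderiv : fderiv ℝ f (γ t) (deriv γ t) = 0 := by
    rw [← fderiv_comp_deriv t hfγ (hγ.differentiable (by simp) t), hconst, deriv_const]
  rwa [← hker _ (hγf t).1.1]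

end TangentDistribution

theorem exists_nhds_forall_reflTransGen_smoothlyJoinedIn {ι : Type*}
    {E : TangentDistribution m M} {L : ι → TangentDistribution m M}
    (hL : ∀ i, (L i).IsIntegrable) (hEL : ∀ z, E.fiber z ≤ ⨆ i, (L i).fiber z)
    {z₀ : M} (hE : E.IsBracketGeneratingNear z₀) {V : Set M} (hV : V ∈ 𝓝 z₀) :
    ∃ W ∈ 𝓝 z₀, ∀ z₁ ∈ W, ∀ z₂ ∈ W,
      Relation.ReflTransGen (fun x y => ∃ i, (L i).SmoothlyJoinedIn V x y) z₁ z₂ := by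
  let ξ₀ := extChartAt (𝓡 m) z₀ z₀
  let G := interior {z | z ∈ V ∧ E.IsBracketGeneratingAt z}
  let Ω := (extChartAt (𝓡 m) z₀).target ∩ chartInv z₀ ⁻¹' G
  have hΩ : IsOpen Ω := isOpen_chartInv_preimage z₀ isOpen_interior
  have hinv (z : M) (hz : z ∈ (extChartAt (𝓡 m) z₀).source) :
      chartInv z₀ (extChartAt (𝓡 m) z₀ z) = z := (extChartAt (𝓡 m) z₀).left_inv hz
  have hξ₀ : ξ₀ ∈ Ω := by
    refine ⟨mem_extChartAt_target z₀, ?_⟩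
    rw [mem_preimage, hinv z₀ (mem_extChartAt_source z₀)]
    exact mem_interior_iff_mem_nhds.2 (inter_mem hV hE)
  choose q f O hmem hO hf hker hjoin using fun (i : ι) (ξ : Ω) =>
    (hL i).exists_plaqueChart (V := V) hΩ (fun η hη => ⟨hη.1, (interior_subset hη.2).1⟩) ξ.2
  let r := SamePlaque (fun j : ι × Ω => f j.1 j.2) (fun j => O j.1 j.2)
  have hrΩ (ξ : EuclideanSpace ℝ (Fin m)) (h : Relation.ReflTransGen r ξ₀ ξ) : ξ ∈ Ω := by
    obtain rfl | ⟨_, -, j, -, hξ, -⟩ := h.cases_tail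
    exacts [hξ₀, hO _ _ hξ]
  have hreach : {ξ | Relation.ReflTransGen r ξ₀ ξ} ∈ 𝓝 ξ₀ := by
    refine setOf_reflTransGen_samePlaque_mem_nhds (D := E.coord z₀) (fun j => hf j.1 j.2)
      (fun ξ hξ => ?_) fun ξ hξ => (interior_subset (hrΩ ξ hξ).2).2.coord (hrΩ ξ hξ).1
    refine (TangentDistribution.coord_le_iSup (hrΩ ξ hξ).1 (hEL _)).trans (iSup_le fun i => ?_)
    rw [← hker i ⟨ξ, hrΩ ξ hξ⟩ ξ (hmem _ _)]
    exact le_iSup₂_of_le (i, ⟨ξ, hrΩ ξ hξ⟩) (hmem _ _) le_rfl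
  refine ⟨_, inter_mem (extChartAt_source_mem_nhds (I := 𝓡 m) z₀)
    (continuousAt_extChartAt z₀ hreach), ?_⟩
  rintro z₁ ⟨hz₁, hr₁⟩ z₂ ⟨hz₂, hr₂⟩
  have hr := equivalence_reflTransGen_samePlaque (fun j : ι × Ω => f j.1 j.2) fun j => O j.1 j.2
  rw [← hinv z₁ hz₁, ← hinv z₂ hz₂]
  refine (hr.trans (hr.symm hr₁) hr₂).lift (chartInv z₀) ?_
  rintro ξ ζ ⟨j, hξ, hζ, h⟩
  exact ⟨j.1, hjoin _ _ ξ hξ ζ hζ h⟩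

end LocalTransitivity

section AbsoluteContinuity

variable {X : Type*} [PseudoMetricSpace X] {f g : ℝ → X} {a b d : ℝ}

theorem absolutelyContinuousOnInterval_congr (hf : AbsolutelyContinuousOnInterval f a b)
    (h : EqOn f g (uIcc a b)) : AbsolutelyContinuousOnInterval g a b := by
  refine Tendsto.congr' ?_ hf
  filter_upwards [mem_inf_of_right (mem_principal_self _)] with E hE
  exact Finset.sum_congr rfl fun i hi => by rw [h (hE.1 i hi).1, h (hE.1 i hi).2]

theorem absolutelyContinuousOnInterval_comp_of_monotone {φ : ℝ → ℝ} (hφ : Monotone φ)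
    (hLip : LipschitzWith 1 φ) (hf : AbsolutelyContinuousOnInterval f (φ a) (φ b)) :
    AbsolutelyContinuousOnInterval (f ∘ φ) a b := by
  rw [absolutelyContinuousOnInterval_iff] at hf ⊢
  intro ε hε
  obtain ⟨δ, hδ, h⟩ := hf ε hε
  refine ⟨δ, hδ, fun I hI hIδ =>
    h (I.1, fun i => (φ (I.2 i).1, φ (I.2 i).2)) ⟨fun i hi => ?_, fun i hi j hj hij => ?_⟩ ?_⟩
  · exact (hI.1 i hi).imp (hφ.mapsTo_uIcc ·) (hφ.mapsTo_uIcc ·)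
  · have hdisj := hI.2 hi hj hij
    simp only [Function.onFun, uIoc, Ioc_disjoint_Ioc, ← hφ.map_min, ← hφ.map_max] at hdisj ⊢
    exact hφ hdisj
  · exact (Finset.sum_le_sum fun i _ => by simpa using hLip.dist_le_mul _ _).trans_lt hIδ

theorem absolutelyContinuousOnInterval_trans {F : Type*} [NormedAddCommGroup F] {f : ℝ → F}
    (hab : a ≤ b) (hbd : b ≤ d) (h₁ : AbsolutelyContinuousOnInterval f a b)
    (h₂ : AbsolutelyContinuousOnInterval f b d) : AbsolutelyContinuousOnInterval f a d := by
  have hmin : AbsolutelyContinuousOnInterval (f ∘ (min · b)) a d :=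
    absolutelyContinuousOnInterval_comp_of_monotone (monotone_id.min monotone_const)
      (LipschitzWith.id.min_const b) (by simpa [hab, hbd] using h₁)
  have hmax : AbsolutelyContinuousOnInterval (f ∘ (max · b)) a d :=
    absolutelyContinuousOnInterval_comp_of_monotone (monotone_id.max monotone_const)
      (LipschitzWith.id.max_const b) (by simpa [hab, hbd] using h₂)
  have hconst : AbsolutelyContinuousOnInterval (fun _ => f b) a d :=
    (LipschitzWith.const (f b)).lipschitzOnWith.absolutelyContinuousOnInterval
  refine absolutelyContinuousOnInterval_congr ((hmin.add hmax).sub hconst) fun t _ => ?_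
  rcases le_total t b with ht | ht <;> simp [ht]

end AbsoluteContinuity

section Concatenation

variable {EU HU U EM HM M : Type*} [NormedAddCommGroup EU] [NormedSpace ℝ EU]
  [TopologicalSpace HU] [TopologicalSpace U] [ChartedSpace HU U] [NormedAddCommGroup EM]
  [NormedSpace ℝ EM] [TopologicalSpace HM] [TopologicalSpace M] [ChartedSpace HM M]
  {IU : ModelWithCorners ℝ EU HU} {I : ModelWithCorners ℝ EM HM} {a b d r : ℝ}

namespace IsAbsolutelyContinuousCurve

variable {x y : ℝ → M}

theorem congr (hx : IsAbsolutelyContinuousCurve I x a b) (h : EqOn x y (Icc a b)) :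
    IsAbsolutelyContinuousCurve I y a b where
  continuousOn := hx.continuousOn.congr h.symm
  absolutelyContinuous q s t hs hst ht hmaps := by
    have hxy : EqOn x y (Icc s t) := h.mono (Icc_subset_Icc hs ht)
    refine absolutelyContinuousOnInterval_congr
      (hx.absolutelyContinuous q s t hs hst ht (hmaps.congr hxy.symm)) fun u hu => ?_
    rw [uIcc_of_le hst] at hu
    rw [hxy hu]

theorem comp_add_const (hx : IsAbsolutelyContinuousCurve I x (a + r) (b + r)) :
    IsAbsolutelyContinuousCurve I (fun t => x (t + r)) a b where
  continuousOn := hx.continuousOn.comp (by fun_prop) fun t ht => by simpa using ht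
  absolutelyContinuous q s t hs hst ht hmaps := by
    refine absolutelyContinuousOnInterval_comp_of_monotone
      (f := fun u => extChartAt I q (x u)) (φ := (· + r)) (add_left_mono (a := r))
      (isometry_add_right r).lipschitz (hx.absolutelyContinuous q _ _ (by gcongr) (by gcongr)
        (by gcongr) fun u hu => ?_)
    simpa using hmaps (sub_mem_Icc_iff_left.2 hu : u - r ∈ Icc s t)

theorem trans (h₁ : IsAbsolutelyContinuousCurve I x a b) (h₂ : IsAbsolutelyContinuousCurve I x b d)
    (hab : a ≤ b) (hbd : b ≤ d) : IsAbsolutelyContinuousCurve I x a d where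
  continuousOn := by
    rw [← Icc_union_Icc_eq_Icc hab hbd]
    exact h₁.continuousOn.union_of_isClosed h₂.continuousOn isClosed_Icc isClosed_Icc
  absolutelyContinuous q s t hs hst ht hmaps := by
    rcases le_total t b with htb | hbt
    · exact h₁.absolutelyContinuous q s t hs hst htb hmaps
    rcases le_total b s with hbs | hsb
    · exact h₂.absolutelyContinuous q s t hbs hst ht hmaps
    · exact absolutelyContinuousOnInterval_trans hsb hbt
        (h₁.absolutelyContinuous q s b hs hsb le_rfl
          (hmaps.mono_left (Icc_subset_Icc_right hbt)))
        (h₂.absolutelyContinuous q b t le_rfl hbt ht (hmaps.mono_left (Icc_subset_Icc_left hsb)))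

end IsAbsolutelyContinuousCurve

namespace ControlSystem

variable [IsManifold I ∞ M] {C : ControlSystem IU U I M} {c c' : ℝ → U}

theorem IsAdmissible.congr (hc : C.IsAdmissible c a b) (hproj : C.proj (c a) = C.proj (c' a))
    (h : EqOn c c' (Ioc a b)) : C.IsAdmissible c' a b where
  aemeasurable := by
    let _ : MeasurableSpace U := borel U
    have hmeas := hc.aemeasurable
    rw [← restrict_Ioo_eq_restrict_Icc] at hmeas ⊢
    refine hmeas.congr ?_
    filter_upwards [ae_restrict_mem measurableSet_Ioo] with t ht using h (Ioo_subset_Ioc_self ht)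
  essentiallyBounded := by
    obtain ⟨Q, hQ, hcQ⟩ := hc.essentiallyBounded
    refine ⟨Q, hQ, ?_⟩
    rw [← restrict_Ioo_eq_restrict_Icc] at hcQ ⊢
    filter_upwards [hcQ, ae_restrict_mem measurableSet_Ioo] with t htQ ht
    rwa [← h (Ioo_subset_Ioc_self ht)]
  absolutelyContinuous := hc.absolutelyContinuous.congr fun t ht => by
    rcases ht.1.eq_or_lt with rfl | hat
    · exact hproj
    · exact congrArg C.proj (h ⟨hat, ht.2⟩)
  hasMFDerivAt := by
    have hderiv := hc.hasMFDerivAt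
    rw [← restrict_Ioo_eq_restrict_Icc] at hderiv ⊢
    filter_upwards [hderiv, ae_restrict_mem measurableSet_Ioo] with t htd ht
    have heq : (fun s => C.proj (c' s)) =ᶠ[𝓝 t] fun s => C.proj (c s) := by
      filter_upwards [Ioo_mem_nhds ht.1 ht.2] with s hs
      rw [h (Ioo_subset_Ioc_self hs)]
    rw [← h (Ioo_subset_Ioc_self ht)]
    exact htd.congr_of_eventuallyEq heq

theorem IsAdmissible.comp_add_const (hc : C.IsAdmissible c (a + r) (b + r)) :
    C.IsAdmissible (fun t => c (t + r)) a b := by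
  let _ : MeasurableSpace U := borel U
  have hadd : MeasurePreserving (· + r) (volume.restrict (Icc a b))
      (volume.restrict (Icc (a + r) (b + r))) := by
    simpa using (measurePreserving_add_right volume r).restrict_preimage
      (measurableSet_Icc (a := a + r) (b := b + r))
  obtain ⟨Q, hQ, hcQ⟩ := hc.essentiallyBounded
  refine ⟨?_, ⟨Q, hQ, hadd.quasiMeasurePreserving.ae hcQ⟩,
    hc.absolutelyContinuous.comp_add_const, ?_⟩
  · exact hc.aemeasurable.comp_quasiMeasurePreserving hadd.quasiMeasurePreserving
  · filter_upwards [hadd.quasiMeasurePreserving.ae hc.hasMFDerivAt] with t ht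
    exact ht.comp t ((hasFDerivAt_id t).add_const r).hasMFDerivAt

theorem IsAdmissible.trans (h₁ : C.IsAdmissible c a b) (h₂ : C.IsAdmissible c b d) (hab : a ≤ b)
    (hbd : b ≤ d) : C.IsAdmissible c a d := by
  let _ : MeasurableSpace U := borel U
  obtain ⟨Q₁, hQ₁, hcQ₁⟩ := h₁.essentiallyBounded
  obtain ⟨Q₂, hQ₂, hcQ₂⟩ := h₂.essentiallyBounded
  refine ⟨?_, ⟨Q₁ ∪ Q₂, hQ₁.union hQ₂, ?_⟩,
    h₁.absolutelyContinuous.trans h₂.absolutelyContinuous hab hbd, ?_⟩ <;>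
  rw [← Icc_union_Icc_eq_Icc hab hbd]
  · exact aemeasurable_union_iff.2 ⟨h₁.aemeasurable, h₂.aemeasurable⟩
  · exact (ae_restrict_union_iff _ _ _).2
      ⟨hcQ₁.mono fun t ht => Or.inl ht, hcQ₂.mono fun t ht => Or.inr ht⟩
  · exact (ae_restrict_union_iff _ _ _).2 ⟨h₁.hasMFDerivAt, h₂.hasMFDerivAt⟩

theorem joinedIn_iff {V : Set M} {x y : M} :
    C.JoinedIn V x y ↔ ∃ (a b : ℝ) (c : ℝ → U), a < b ∧ C.IsAdmissible c a b ∧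
      (∀ t ∈ Icc a b, C.proj (c t) ∈ V) ∧ C.proj (c a) = x ∧ C.proj (c b) = y := by
  constructor
  · rintro ⟨a, b, z, hab, ⟨c, hc, hz⟩, hV, hx, hy⟩
    refine ⟨a, b, c, hab, hc, fun t ht => hz t ht ▸ hV t ht, ?_, ?_⟩
    · rw [← hz a (left_mem_Icc.2 hab.le), hx]
    · rw [← hz b (right_mem_Icc.2 hab.le), hy]
  · rintro ⟨a, b, c, hab, hc, hV, hx, hy⟩
    exact ⟨a, b, fun t => C.proj (c t), hab, ⟨c, hc, fun _ _ => rfl⟩, hV, hx, hy⟩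

theorem JoinedIn.trans {V : Set M} {x y z : M} (h₁ : C.JoinedIn V x y) (h₂ : C.JoinedIn V y z) :
    C.JoinedIn V x z := by
  obtain ⟨a, b, c₁, hab, hc₁, hV₁, hx, hy⟩ := joinedIn_iff.1 h₁
  obtain ⟨a', b', c₂, hab', hc₂, hV₂, hy', hz⟩ := joinedIn_iff.1 h₂
  obtain ⟨r, rfl⟩ : ∃ r, b + r = a' := ⟨a' - b, by ring⟩
  obtain ⟨d, rfl⟩ : ∃ d, d + r = b' := ⟨b' - r, by ring⟩
  have hbd : b < d := lt_of_add_lt_add_right hab'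
  let c : ℝ → U := fun t => if t ≤ b then c₁ t else c₂ (t + r)
  have hcle (t : ℝ) (ht : t ≤ b) : c t = c₁ t := if_pos ht
  have hcgt (t : ℝ) (ht : b < t) : c t = c₂ (t + r) := if_neg ht.not_ge
  refine joinedIn_iff.2 ⟨a, d, c, hab.trans hbd, .trans (b := b) ?_ ?_ hab.le hbd.le,
    fun t ht => ?_, ?_, ?_⟩
  · exact hc₁.congr (by rw [hcle a hab.le]) fun t ht => (hcle t ht.2).symm
  · exact hc₂.comp_add_const.congr (by rw [hcle b le_rfl, hy, hy']) fun t ht => (hcgt t ht.1).symm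
  · rcases le_or_gt t b with htb | htb
    · rw [hcle t htb]
      exact hV₁ t ⟨ht.1, htb⟩
    · rw [hcgt t htb]
      exact hV₂ _ ⟨by gcongr, by gcongr; exact ht.2⟩
  · rw [hcle a hab.le, hx]
  · rw [hcgt d hbd, hz]

end ControlSystem

end Concatenation

section Continuity

variable {m : ℕ} {M : Type*} [TopologicalSpace M]
  [ChartedSpace (EuclideanSpace ℝ (Fin m)) M] [IsManifold (𝓡 m) ∞ M]

namespace TangentDistribution

theorem injective_frameMatrix {r : ℕ} {D : ∀ z : M, Submodule ℝ (TangentSpace (𝓡 m) z)}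
    {s : Fin r → ∀ z : M, TangentSpace (𝓡 m) z} {O : Set M} (hs : IsFrameOn D s O) {z₀ z : M}
    (hz : z ∈ O ∩ (trivializationAt (EuclideanSpace ℝ (Fin m)) (TangentSpace (𝓡 m)) z₀).baseSet) :
    Function.Injective (frameMatrix s z₀ z) := by
  intro a b hab
  rw [frameMatrix_apply s hz.2, frameMatrix_apply s hz.2] at hab
  refine hs.injective hz.1 ?_
  rw [← Trivialization.symmₗ_linearMapAt (R := ℝ) _ hz.2 (frameMap s z a), hab,
    Trivialization.symmₗ_linearMapAt _ hz.2]

theorem exists_trivializationAt_incl_eq (D : TangentDistribution m M) (z₀ : M) :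
    ∃ A : M → EuclideanSpace ℝ (Fin D.rank) →L[ℝ] EuclideanSpace ℝ (Fin m),
      ContinuousAt A z₀ ∧ Function.Injective (A z₀) ∧ ∀ᶠ z in 𝓝 z₀, ∀ v : D.Fib z,
        (trivializationAt (EuclideanSpace ℝ (Fin m)) (TangentSpace (𝓡 m)) z₀ (D.incl ⟨z, v⟩)).2 =
          A z (trivializationAt (EuclideanSpace ℝ (Fin D.rank)) D.Fib z₀ ⟨z, v⟩).2 := by
  obtain ⟨hO, hzO, hs⟩ := (D.exists_frame z₀).choose_spec
  have hs := hs.choose_spec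
  have hnhds := (hO.inter (Trivialization.open_baseSet _)).mem_nhds
    ⟨hzO, FiberBundle.mem_baseSet_trivializationAt' (F := EuclideanSpace ℝ (Fin m))
      (E := (TangentSpace (𝓡 m) : M → Type _)) z₀⟩
  refine ⟨frameMatrix _ z₀, ((contMDiffOn_frameMatrix hO hs z₀).contMDiffAt hnhds).continuousAt,
    injective_frameMatrix hs (mem_of_mem_nhds hnhds), ?_⟩
  filter_upwards [hnhds] with z hz v
  have hv : (trivializationAt (EuclideanSpace ℝ (Fin D.rank)) D.Fib z₀ ⟨z, v⟩).2 =
      (hs.equiv hz.1).symm v :=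
    congrArg Prod.snd (D.framePretrivialization_apply hO hs hz.1 v)
  rw [hv, frameMatrix_apply _ hz.2, ← hs.coe_equiv hz.1, LinearEquiv.apply_symm_apply,
    Trivialization.coe_linearMapAt_of_mem _ hz.2]
  rfl

theorem continuous_of_continuous_incl (D : TangentDistribution m M)
    {T : Type*} [TopologicalSpace T] {c : T → D.Total} (h : Continuous fun t => D.incl (c t)) :
    Continuous c := by
  rw [continuous_iff_continuousAt]
  intro t
  obtain ⟨hproj, hvel⟩ := (FiberBundle.continuousAt_totalSpace (EuclideanSpace ℝ (Fin m))
    (fun t => D.incl (c t))).1 h.continuousAt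
  have hproj : ContinuousAt (fun u => (c u).proj) t := hproj
  refine (FiberBundle.continuousAt_totalSpace (EuclideanSpace ℝ (Fin D.rank)) c).2 ⟨hproj, ?_⟩
  obtain ⟨A, hA, hinj, hAincl⟩ := D.exists_trivializationAt_incl_eq (c t).proj
  obtain ⟨B, hB, hBA⟩ := exists_contDiffAt_leftInverse hinj
  have hA : ContinuousAt (fun u => A (c u).proj) t := hA.comp (f := fun u => (c u).proj) hproj
  have hBvel := (hB.continuousAt.comp (f := fun u => A (c u).proj) hA).clm_apply hvel
  refine hBvel.congr ?_
  filter_upwards [hA.eventually hBA, hproj.eventually hAincl] with u hBu hAu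
  exact (congrArg _ (hAu (c u).snd)).trans (hBu _)

end TangentDistribution

end Continuity

section SmoothTrajectories

variable {EM HM M : Type*} [NormedAddCommGroup EM] [NormedSpace ℝ EM] [TopologicalSpace HM]
  [TopologicalSpace M] [ChartedSpace HM M] {I : ModelWithCorners ℝ EM HM} [IsManifold I ∞ M]

theorem isAbsolutelyContinuousCurve_of_contMDiff {γ : ℝ → M} (hγ : ContMDiff 𝓘(ℝ, ℝ) I ∞ γ)
    (a b : ℝ) : IsAbsolutelyContinuousCurve I γ a b where
  continuousOn := hγ.continuous.continuousOn
  absolutelyContinuous q c d _ hcd _ hmaps := by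
    have hsmooth : ContDiffOn ℝ 1 (fun t => extChartAt I q (γ t)) (uIcc c d) := by
      rw [uIcc_of_le hcd]
      intro t ht
      have hq : ContMDiffAt 𝓘(ℝ, ℝ) 𝓘(ℝ, EM) ∞ (fun t => extChartAt I q (γ t)) t :=
        (contMDiffAt_extChartAt' (hmaps ht)).comp t hγ.contMDiffAt
      exact (hq.contDiffAt.of_le (by norm_cast)).contDiffWithinAt
    exact hsmooth.absolutelyContinuousOnInterval

namespace ControlSystem

variable {EU HU U : Type*} [NormedAddCommGroup EU] [NormedSpace ℝ EU] [TopologicalSpace HU]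
  [TopologicalSpace U] [ChartedSpace HU U] {IU : ModelWithCorners ℝ EU HU}
  (C : ControlSystem IU U I M) {c : ℝ → U}

theorem isAdmissible_of_continuous (hc : Continuous c)
    (hγ : ContMDiff 𝓘(ℝ, ℝ) I ∞ fun t => C.proj (c t))
    (hd : ∀ t, mfderiv 𝓘(ℝ, ℝ) I (fun t => C.proj (c t)) t (1 : ℝ) = C.vel (c t)) (a b : ℝ) :
    C.IsAdmissible c a b where
  aemeasurable := by
    let _ : MeasurableSpace U := borel U
    have : BorelSpace U := ⟨rfl⟩
    exact hc.aemeasurable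
  essentiallyBounded := by
    refine ⟨c '' Icc a b, isCompact_Icc.image hc, ?_⟩
    filter_upwards [ae_restrict_mem measurableSet_Icc] with t ht using mem_image_of_mem c ht
  absolutelyContinuous := isAbsolutelyContinuousCurve_of_contMDiff hγ a b
  hasMFDerivAt := by
    refine Eventually.of_forall fun t => ?_
    have hvel : (1 : ℝ →L[ℝ] ℝ).smulRight (C.vel (c t) : EM) =
        (mfderiv 𝓘(ℝ, ℝ) I (fun t => C.proj (c t)) t : ℝ →L[ℝ] EM) :=
      ContinuousLinearMap.ext_ring ((one_smul ℝ (C.vel (c t) : EM)).trans (hd t).symm)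
    exact hvel ▸ ((hγ t).mdifferentiableAt (by simp)).hasMFDerivAt

theorem joinedIn_of_continuous (hc : Continuous c)
    (hγ : ContMDiff 𝓘(ℝ, ℝ) I ∞ fun t => C.proj (c t))
    (hd : ∀ t, mfderiv 𝓘(ℝ, ℝ) I (fun t => C.proj (c t)) t (1 : ℝ) = C.vel (c t)) {V : Set M}
    (hV : ∀ t, C.proj (c t) ∈ V) : C.JoinedIn V (C.proj (c 0)) (C.proj (c 1)) :=
  joinedIn_iff.2 ⟨0, 1, c, one_pos, C.isAdmissible_of_continuous hc hγ hd 0 1, fun t _ => hV t,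
    rfl, rfl⟩

end ControlSystem

theorem continuous_velocity {γ : ℝ → M} (hγ : ContMDiff 𝓘(ℝ, ℝ) I ∞ γ) :
    Continuous fun t => (⟨γ t, mfderiv 𝓘(ℝ, ℝ) I γ t (1 : ℝ)⟩ : TangentBundle I M) := by
  have hunit : Continuous fun t : ℝ => (⟨t, (1 : ℝ)⟩ : TangentBundle 𝓘(ℝ, ℝ) ℝ) :=
    (tangentBundleModelSpaceHomeomorph 𝓘(ℝ, ℝ)).symm.continuous.comp
      (f := fun t : ℝ => (t, (1 : ℝ))) (by fun_prop)
  exact Continuous.comp (g := tangentMap 𝓘(ℝ, ℝ) I γ) (hγ.continuous_tangentMap (by simp)) hunit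

end SmoothTrajectories

theorem IsFibration.isOpenMap {EX HX X EY HY Y : Type*} [NormedAddCommGroup EX] [NormedSpace ℝ EX]
    [TopologicalSpace HX] [TopologicalSpace X] [ChartedSpace HX X] [NormedAddCommGroup EY]
    [NormedSpace ℝ EY] [TopologicalSpace HY] [TopologicalSpace Y] [ChartedSpace HY Y]
    {I : ModelWithCorners ℝ EX HX} {J : ModelWithCorners ℝ EY HY} {pr : X → Y}
    (h : IsFibration I J pr) : IsOpenMap pr := by
  refine isOpenMap_iff_nhds_le.2 fun z => ?_
  obtain ⟨_, F, _, _, _, e, he, -⟩ := h.locallyTrivial (pr z)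
  exact (e.map_proj_nhds (e.mem_source.2 he)).ge

section LocalControllability

variable {m n : ℕ} {M N : Type*} [TopologicalSpace M]
  [ChartedSpace (EuclideanSpace ℝ (Fin m)) M] [IsManifold (𝓡 m) ∞ M] [TopologicalSpace N]
  [ChartedSpace (EuclideanSpace ℝ (Fin n)) N] [IsManifold (𝓡 n) ∞ N]

namespace TangentDistribution

variable {D L : TangentDistribution m M} {x y : M}

theorem SmoothlyJoinedIn.joinedIn {V : Set M} (h : L.SmoothlyJoinedIn V x y)
    (hLD : ∀ z, L.fiber z ≤ D.fiber z) : D.controlSystem.JoinedIn V x y := by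
  obtain ⟨γ, hγ, rfl, rfl, hγL⟩ := h
  let c : ℝ → D.Total := fun t => ⟨γ t, _, hLD _ (hγL t).2⟩
  have hc : Continuous c := D.continuous_of_continuous_incl (continuous_velocity hγ)
  exact D.controlSystem.joinedIn_of_continuous hc hγ (fun _ => rfl) fun t => (hγL t).1

theorem joinedIn_quotient {pr : M → N} (hpr : IsFibration (𝓡 m) (𝓡 n) pr)
    (hD : IsFibration ((𝓡 m).prod (𝓡 D.rank)) (𝓡 n) (pr ∘ D.controlSystem.proj)) {V : Set N}
    {c : ℝ → D.Total} (hc : Continuous c) (hγ : ContMDiff 𝓘(ℝ, ℝ) (𝓡 m) ∞ fun t => (c t).proj)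
    (hd : ∀ t, mfderiv (𝓡 m) (𝓡 n) pr (c t).proj
      (mfderiv 𝓘(ℝ, ℝ) (𝓡 m) (fun t => (c t).proj) t (1 : ℝ)) =
        mfderiv (𝓡 m) (𝓡 n) pr (c t).proj (c t).snd)
    (hV : ∀ t, pr (c t).proj ∈ V) :
    (D.controlSystem.quotient pr hpr hD).JoinedIn V (pr (c 0).proj) (pr (c 1).proj) := by
  refine (D.controlSystem.quotient pr hpr hD).joinedIn_of_continuous hc (hpr.contMDiff.comp hγ)
    (fun t => Eq.trans ?_ (hd t)) hV
  exact congrArg (fun A : ℝ →L[ℝ] EuclideanSpace ℝ (Fin n) => A 1)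
    (mfderiv_comp t (hpr.contMDiff.mdifferentiableAt (by simp))
      (hγ.mdifferentiableAt (by simp)))

theorem SmoothlyJoinedIn.joinedIn_quotient {pr : M → N} (hpr : IsFibration (𝓡 m) (𝓡 n) pr)
    (hD : IsFibration ((𝓡 m).prod (𝓡 D.rank)) (𝓡 n) (pr ∘ D.controlSystem.proj)) {V : Set N}
    (h : L.SmoothlyJoinedIn (pr ⁻¹' V) x y)
    (hL : (∀ z, L.fiber z ≤ D.fiber z) ∨ ∀ z, L.fiber z ≤ (mfderiv (𝓡 m) (𝓡 n) pr z).ker) :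
    (D.controlSystem.quotient pr hpr hD).JoinedIn V (pr x) (pr y) := by
  obtain ⟨γ, hγ, rfl, rfl, hγL⟩ := h
  rcases hL with hLD | hLker
  · let c : ℝ → D.Total := fun t => ⟨γ t, _, hLD _ (hγL t).2⟩
    have hc : Continuous c := D.continuous_of_continuous_incl (continuous_velocity hγ)
    exact joinedIn_quotient hpr hD hc hγ (fun _ => rfl) fun t => (hγL t).1
  · let c : ℝ → D.Total := fun t => ⟨γ t, 0⟩
    have hc : Continuous c := D.continuous_of_continuous_incl
      ((contMDiff_zeroSection ℝ (TangentSpace (𝓡 m) : M → Type _) (IB := 𝓡 m) (n := ∞)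
        (F := EuclideanSpace ℝ (Fin m))).continuous.comp hγ.continuous)
    refine joinedIn_quotient hpr hD hc hγ (fun t => ?_) fun t => (hγL t).1
    exact (LinearMap.mem_ker.1 (hLker _ (hγL t).2)).trans (map_zero _).symm

end TangentDistribution

section Family

variable {ι : Type*} {E : TangentDistribution m M} {L : ι → TangentDistribution m M} {z₀ : M}

theorem locallyControllableAt_of_joinedIn (hL : ∀ i, (L i).IsIntegrable)
    (hEL : ∀ z, E.fiber z ≤ ⨆ i, (L i).fiber z) (hE : E.IsBracketGeneratingNear z₀)
    {EU HU U : Type*} [NormedAddCommGroup EU] [NormedSpace ℝ EU] [TopologicalSpace HU]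
    [TopologicalSpace U] [ChartedSpace HU U] {IU : ModelWithCorners ℝ EU HU}
    (C : ControlSystem IU U (𝓡 n) N) {pr : M → N} (hpr : Continuous pr) (hopen : IsOpenMap pr)
    (hrefl : ∀ V x, pr x ∈ V → C.JoinedIn V (pr x) (pr x))
    (hstep : ∀ i V x y, (L i).SmoothlyJoinedIn (pr ⁻¹' V) x y → C.JoinedIn V (pr x) (pr y)) :
    C.LocallyControllableAt (pr z₀) := by
  intro V hV hz₀
  obtain ⟨W, hW, hjoin⟩ := exists_nhds_forall_reflTransGen_smoothlyJoinedIn hL hEL hE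
    ((hV.preimage hpr).mem_nhds hz₀)
  refine ⟨V ∩ pr '' interior W, hV.inter (hopen _ isOpen_interior),
    ⟨hz₀, mem_image_of_mem pr (mem_interior_iff_mem_nhds.2 hW)⟩, inter_subset_left, ?_⟩
  rintro _ ⟨hz₁V, z₁, hz₁, rfl⟩ _ ⟨-, z₂, hz₂, rfl⟩
  have hpath := hjoin z₁ (interior_subset hz₁) z₂ (interior_subset hz₂)
  clear hz₂
  induction hpath with
  | refl => exact hrefl V z₁ hz₁V
  | tail _ h ih =>
    obtain ⟨i, hi⟩ := h
    exact ih.trans (hstep i V _ _ hi)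

variable {D : TangentDistribution m M}

theorem locallyControllableAt_controlSystem (hL : ∀ i, (L i).IsIntegrable)
    (hEL : ∀ z, E.fiber z ≤ ⨆ i, (L i).fiber z) (hE : E.IsBracketGeneratingNear z₀)
    (hLD : ∀ i z, (L i).fiber z ≤ D.fiber z) : D.controlSystem.LocallyControllableAt z₀ :=
  locallyControllableAt_of_joinedIn hL hEL hE D.controlSystem continuous_id .id
    (fun _ _ hx => (TangentDistribution.SmoothlyJoinedIn.refl D hx).joinedIn fun _ => le_rfl)
    fun i _ _ _ h => h.joinedIn (hLD i)

theorem locallyControllableAt_quotient (hL : ∀ i, (L i).IsIntegrable)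
    (hEL : ∀ z, E.fiber z ≤ ⨆ i, (L i).fiber z) (hE : E.IsBracketGeneratingNear z₀) {pr : M → N}
    (hpr : IsFibration (𝓡 m) (𝓡 n) pr)
    (hD : IsFibration ((𝓡 m).prod (𝓡 D.rank)) (𝓡 n) (pr ∘ D.controlSystem.proj))
    (hLpr : ∀ i, (∀ z, (L i).fiber z ≤ D.fiber z) ∨
      ∀ z, (L i).fiber z ≤ (mfderiv (𝓡 m) (𝓡 n) pr z).ker) :
    (D.controlSystem.quotient pr hpr hD).LocallyControllableAt (pr z₀) :=
  locallyControllableAt_of_joinedIn hL hEL hE _ hpr.contMDiff.continuous hpr.isOpenMap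
    (fun V _ hx => (TangentDistribution.SmoothlyJoinedIn.refl D
      (V := pr ⁻¹' V) hx).joinedIn_quotient hpr hD (.inl fun _ => le_rfl))
    fun i _ _ _ h => h.joinedIn_quotient hpr hD (hLpr i)

end Family

end LocalControllability

end PseudoProduct

theorem lemma5p2_general {m n : ℕ} {M N ι : Type*} [TopologicalSpace M]
    [ChartedSpace (EuclideanSpace ℝ (Fin m)) M] [IsManifold (𝓡 m) ∞ M] [TopologicalSpace N]
    [ChartedSpace (EuclideanSpace ℝ (Fin n)) N] [IsManifold (𝓡 n) ∞ N]
    {E : TangentDistribution m M} {L : ι → TangentDistribution m M} (hL : ∀ i, (L i).IsIntegrable)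
    (hEL : ∀ z, ⨆ i, (L i).fiber z = E.fiber z) {z₀ : M} (hE : E.IsBracketGeneratingNear z₀) :
    E.controlSystem.LocallyControllableAt z₀ ∧
    ∀ (pr : M → N) (hpr : IsFibration (𝓡 m) (𝓡 n) pr),
      (∀ hEN : IsFibration ((𝓡 m).prod (𝓡 E.rank)) (𝓡 n) (pr ∘ E.controlSystem.proj),
        (E.controlSystem.quotient pr hpr hEN).LocallyControllableAt (pr z₀)) ∧
      ∀ j, (∀ i ≠ j, ∀ z, (L i).fiber z ≤ (mfderiv (𝓡 m) (𝓡 n) pr z).ker) →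
        ∀ hLN : IsFibration ((𝓡 m).prod (𝓡 (L j).rank)) (𝓡 n) (pr ∘ (L j).controlSystem.proj),
          ((L j).controlSystem.quotient pr hpr hLN).LocallyControllableAt (pr z₀) := by
  have hEL_le (z : M) : E.fiber z ≤ ⨆ i, (L i).fiber z := (hEL z).ge
  have hLE (i : ι) (z : M) : (L i).fiber z ≤ E.fiber z :=
    (le_iSup (fun i => (L i).fiber z) i).trans (hEL z).le
  refine ⟨locallyControllableAt_controlSystem hL hEL_le hE hLE, fun pr hpr =>
    ⟨fun hEN => locallyControllableAt_quotient hL hEL_le hE hpr hEN fun i => .inl (hLE i),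
      fun j hker hLN => locallyControllableAt_quotient hL hEL_le hE hpr hLN fun i => ?_⟩⟩
  obtain rfl | hij := eq_or_ne i j
  exacts [.inl fun _ => le_rfl, .inr (hker i hij)]

theorem lemma5p2 {m n p : ℕ} {M N P : Type*}
    [TopologicalSpace M] [T2Space M] [SecondCountableTopology M]
    [ChartedSpace (EuclideanSpace ℝ (Fin m)) M] [IsManifold (𝓡 m) ∞ M]
    [TopologicalSpace N] [T2Space N] [SecondCountableTopology N]
    [ChartedSpace (EuclideanSpace ℝ (Fin n)) N] [IsManifold (𝓡 n) ∞ N]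
    [TopologicalSpace P] [T2Space P] [SecondCountableTopology P]
    [ChartedSpace (EuclideanSpace ℝ (Fin p)) P] [IsManifold (𝓡 p) ∞ P]
    (S : PseudoProductStructure m M) (z₀ : M) (hS : S.E.IsBracketGeneratingNear z₀) :
    S.E.controlSystem.LocallyControllableAt z₀ ∧
    (∀ (πN : M → N) (hπN : IsFibration (𝓡 m) (𝓡 n) πN),
      (∀ z, (mfderiv (𝓡 m) (𝓡 n) πN z).ker = S.K.fiber z) →
      (∀ hEN : IsFibration ((𝓡 m).prod (𝓡 S.E.rank)) (𝓡 n) (πN ∘ S.E.controlSystem.proj),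
        (S.E.controlSystem.quotient πN hπN hEN).LocallyControllableAt (πN z₀)) ∧
      (∀ hLN : IsFibration ((𝓡 m).prod (𝓡 S.L.rank)) (𝓡 n) (πN ∘ S.L.controlSystem.proj),
        (S.L.controlSystem.quotient πN hπN hLN).LocallyControllableAt (πN z₀))) ∧
    (∀ (πP : M → P) (hπP : IsFibration (𝓡 m) (𝓡 p) πP),
      (∀ z, (mfderiv (𝓡 m) (𝓡 p) πP z).ker = S.L.fiber z) →
      (∀ hEP : IsFibration ((𝓡 m).prod (𝓡 S.E.rank)) (𝓡 p) (πP ∘ S.E.controlSystem.proj),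
        (S.E.controlSystem.quotient πP hπP hEP).LocallyControllableAt (πP z₀)) ∧
      (∀ hKP : IsFibration ((𝓡 m).prod (𝓡 S.K.rank)) (𝓡 p) (πP ∘ S.K.controlSystem.proj),
        (S.K.controlSystem.quotient πP hπP hKP).LocallyControllableAt (πP z₀))) := by
  let L : Bool → TangentDistribution m M := fun b => cond b S.L S.K
  have hL : ∀ b, (L b).IsIntegrable := Bool.forall_bool.2 ⟨S.integrable_K, S.integrable_L⟩
  have hEL (z : M) : ⨆ b, (L b).fiber z = S.E.fiber z := by
    rw [← S.sup_eq z, iSup_bool_eq]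
    rfl
  have hN := lemma5p2_general (n := n) (N := N) hL hEL hS
  have hP := lemma5p2_general (n := p) (N := P) hL hEL hS
  refine ⟨hN.1, fun πN hπN hker => ⟨(hN.2 πN hπN).1, (hN.2 πN hπN).2 true ?_⟩,
    fun πP hπP hker => ⟨(hP.2 πP hπP).1, (hP.2 πP hπP).2 false ?_⟩⟩
  · exact Bool.forall_bool.2 ⟨fun _ z => (hker z).ge, fun h => absurd rfl h⟩
  · exact Bool.forall_bool.2 ⟨fun h => absurd rfl h, fun _ z => (hker z).ge⟩
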